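/- Let $G$ be a finite group. Let $B(G,G)$ be the double Burnside ring of $G$, i.e. the Grothendieck group of finite $(G,G)$-bisets under disjoint union, with multiplication induced by $[X][Y]=[X\times_G Y]$ and identity $\mathrm{Id}_G=[G]$; the transitive bisets are the $[G\times G/M]$ for subgroups $M\leqslant G\times G$, where $g\cdot (a,b)M\cdot h=(ga,h^{-1}b)M$. Let $a\mapsto a^\circ$ be the anti-involution of $B(G,G)$ induced by taking opposite bisets, and let $$B_\circ(G,G)=\{u\in B(G,G)^\times : uu^\circ=u^\circ u=\mathrm{Id}_G\}$$ be the group of orthogonal units. For $\varphi\in\mathrm{Aut}(G)$ put $\Delta_\varphi(G)=\{(\varphi(h),h): h\in G\}$ and write $\overline\varphi$ for its class in $\mathrm{Out}(G)=\mathrm{Aut}(G)/\mathrm{Inn}(G)$. Let $\rho:B(G,G)\to\mathbb{Z}\mathrm{Out}(G)$ be the ring homomorphism sending $[G\times G/\Delta_\varphi(G)]$ to $\overline\varphi$ and sending $[G\times G/M]$ to $0$ if $M$ is not of the form $\Delta_\varphi(G)$, and let $\eta:\mathbb{Z}\mathrm{Out}(G)\to B(G,G)$ be the ring homomorphism with $\eta(\overline\varphi)=[G\times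 G/\Delta_\varphi(G)]$. For $M\leqslant G\times G$ let $P_1(M),P_2(M)$ be its projections to the two factors, $K_1(M)=\{g:(g,1)\in M\}$ and $K_2(M)=\{h:(1,h)\in M\}$, and let $I_G\subseteq B(G,G)$ be the additive subgroup spanned by the $[G\times G/M]$ with $|P_1(M)/K_1(M)|=|P_2(M)/K_2(M)|<|G|$. Let $\langle -1,\mathrm{Out}(G)\rangle$ be the subgroup of $(\mathbb{Z}\mathrm{Out}(G))^\times$ generated by $-1$ and $\mathrm{Out}(G)$. Then: (i) For each $\gamma\in B_\circ(G,G)$ there are a unique $\overline\varphi\in\mathrm{Out}(G)$ and a unique $\epsilon\in\{\pm1\}$ with $\rho(\gamma)=\epsilon\overline\varphi$, and $\rho$ restricts to a surjective group homomorphism $\rho^\times:B_\circ(G,G)\to\langle -1,\mathrm{Out}(G)\rangle$. (ii) The map $\eta$ restricts to an injective group homomorphism $\eta:\langle -1,\mathrm{Out}(G)\rangle\to B_\circ(G,G)$ with $\rho^\times\circ\eta=\mathrm{id}$. In particular, $B_\circ(G,G)=\mathrm{im}(\eta)\ltimes\ker(\rho^\times)$. (iii) The map $u\mapsto \mathrm{Id}_G-u$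 is a one-to-one correspondence between $\ker(\rho^\times)$ and the set of elements $a\in I_G$ such that $aa^\circ=a^\circ a=a+a^\circ$. (iv) For a normal subgroup $N$ of $G$ let $\mathrm{Inf}_{G/N}^G$ and $\mathrm{Def}_{G/N}^G$ be the set $G/N$ regarded as a $(G,G/N)$-biset and as a $(G/N,G)$-biset, respectively, and let $\mathrm{dBInf}_{G/N}^G:B_\circ(G/N,G/N)\to B_\circ(G,G)$ be the group homomorphism $u\mapsto \mathrm{Id}_G+\mathrm{Inf}_{G/N}^G\circ(u-\mathrm{Id}_{G/N})\circ\mathrm{Def}_{G/N}^G$, where $\circ$ is induced by the tensor product of bisets. If $N$ is nontrivial, then $\mathrm{im}(\mathrm{dBInf}_{G/N}^G)\leqslant\ker(\rho^\times)$. -/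

import Mathlib

universe u

namespace DoubleBurnside

open scoped RightActions

/-! ### Bisets -/

section Bisets

variable {G H K L : Type u} [Group G] [Group H] [Group K] [Group L]

/-- A finite `(G, H)`-biset: a finite set with a left `G`-action and a right `H`-action
(an action of `Hᵐᵒᵖ`, written `x <• h`) which commute with each other. -/
structure Biset (G H : Type u) [Group G] [Group H] : Type (u + 1) where
  carrier : Type u
  [finite : Finite carrier]
  [left : MulAction G carrier]
  [right : MulAction Hᵐᵒᵖ carrier]
  [comm : SMulCommClass G Hᵐᵒᵖ carrier]

namespace Biset

instance : CoeSort (Biset G H) (Type u) := ⟨Biset.carrier⟩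

attribute [instance] Biset.finite Biset.left Biset.right Biset.comm

/-- Isomorphism of `(G, H)`-bisets. -/
def Iso (X Y : Biset G H) : Prop :=
  ∃ e : X ≃ Y, (∀ (g : G) (x : X), e (g • x) = g • e x) ∧
    ∀ (x : X) (h : H), e (x <• h) = e x <• h

theorem Iso.refl (X : Biset G H) : Iso X X :=
  ⟨Equiv.refl _, fun _ _ => rfl, fun _ _ => rfl⟩

theorem Iso.symm {X Y : Biset G H} : Iso X Y → Iso Y X := by
  rintro ⟨e, h1, h2⟩
  refine ⟨e.symm, fun g x => ?_, fun x h => ?_⟩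
  · rw [Equiv.symm_apply_eq, h1, Equiv.apply_symm_apply]
  · rw [Equiv.symm_apply_eq, h2, Equiv.apply_symm_apply]

theorem Iso.trans {X Y Z : Biset G H} : Iso X Y → Iso Y Z → Iso X Z := by
  rintro ⟨e, h1, h2⟩ ⟨f, k1, k2⟩
  exact ⟨e.trans f, fun g x => by simp [h1, k1], fun x h => by simp [h2, k2]⟩

/-- An equivariant bijection is an isomorphism. -/
theorem Iso.of_bijective {X Y : Biset G H} (f : X → Y) (hf : Function.Bijective f)
    (h1 : ∀ (g : G) (x : X), f (g • x) = g • f x)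
    (h2 : ∀ (x : X) (h : H), f (x <• h) = f x <• h) : Iso X Y :=
  ⟨Equiv.ofBijective f hf, h1, h2⟩

instance isoSetoid (G H : Type u) [Group G] [Group H] : Setoid (Biset G H) :=
  ⟨Iso, Iso.refl, Iso.symm, Iso.trans⟩

/-- A finite `(G, H)`-biset from its left and right multiplication maps. -/
def ofOps (X : Type u) [Finite X] (l : G → X → X) (r : X → H → X)
    (one_l : ∀ x, l 1 x = x) (mul_l : ∀ g g' x, l (g * g') x = l g (l g' x))
    (r_one : ∀ x, r x 1 = x) (r_mul : ∀ x h h', r x (h * h') = r (r x h) h')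
    (hlr : ∀ g x h, l g (r x h) = r (l g x) h) : Biset G H :=
  letI : MulAction G X := { smul := l, one_smul := one_l, mul_smul := mul_l }
  letI : MulAction Hᵐᵒᵖ X :=
    { smul := fun h x => r x h.unop
      one_smul := r_one
      mul_smul := fun h h' x => r_mul x h'.unop h.unop }
  haveI : SMulCommClass G Hᵐᵒᵖ X := ⟨fun g h x => hlr g x h.unop⟩
  { carrier := X }

theorem act_mul {X : Biset G H} (x : X) (h h' : H) : x <• (h * h') = (x <• h) <• h' := by
  rw [MulOpposite.op_mul, mul_smul]

/-- The empty biset. -/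
def empty (G H : Type u) [Group G] [Group H] : Biset G H :=
  ofOps PEmpty.{u + 1} (fun _ x => x) (fun x _ => x) (fun _ => rfl) (fun _ _ _ => rfl)
    (fun _ => rfl) (fun _ _ _ => rfl) (fun _ _ _ => rfl)

/-- The disjoint union of two bisets. -/
def sum (X Y : Biset G H) : Biset G H where
  carrier := X ⊕ Y

/-- The relation on `X × Y` whose classes are the `H`-orbits for `h • (x, y) = (x h⁻¹, h y)`. -/
def tensorSetoid (X : Biset G H) (Y : Biset H K) : Setoid (X × Y) where
  r p q := ∃ h : H, q = (p.1 <• h⁻¹, h • p.2)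
  iseqv :=
    { refl := fun p => ⟨1, by simp⟩
      symm := by
        rintro p q ⟨h, rfl⟩
        exact ⟨h⁻¹, by simp⟩
      trans := by
        rintro p q r ⟨h, rfl⟩ ⟨k, rfl⟩
        exact ⟨k * h, by simp [mul_smul]⟩ }

/-- The tensor product `X ×_H Y` of bisets: the set of `H`-orbits on `X × Y`, with
`g • (x, y) = (g x, y)` and `(x, y) • k = (x, y k)`. -/
def tensor (X : Biset G H) (Y : Biset H K) : Biset G K :=
  ofOps (Quotient (tensorSetoid X Y))
    (fun g => Quotient.map (fun p => (g • p.1, p.2)) (by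
      rintro p q ⟨h, rfl⟩
      exact ⟨h, by simp [smul_comm]⟩))
    (fun z k => Quotient.map (fun p => (p.1, p.2 <• k)) (by
      rintro p q ⟨h, rfl⟩
      exact ⟨h, by simp [smul_comm]⟩) z)
    (by
      rintro ⟨x, y⟩
      exact congrArg (Quotient.mk _) (by simp))
    (by
      rintro g g' ⟨x, y⟩
      exact congrArg (Quotient.mk _) (by simp [mul_smul]))
    (by
      rintro ⟨x, y⟩
      exact congrArg (Quotient.mk _) (by simp))
    (by
      rintro ⟨x, y⟩ k k'
      exact congrArg (Quotient.mk _) (by simp [mul_smul]))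
    (by
      rintro g ⟨x, y⟩ k
      rfl)

/-- The class `(x, _H y)` in `X ×_H Y`. -/
def tmk {X : Biset G H} {Y : Biset H K} (x : X) (y : Y) : tensor X Y :=
  Quotient.mk (tensorSetoid X Y) (x, y)

theorem smul_tmk {X : Biset G H} {Y : Biset H K} (g : G) (x : X) (y : Y) :
    g • tmk x y = tmk (g • x) y := rfl

theorem tmk_smul {X : Biset G H} {Y : Biset H K} (x : X) (y : Y) (k : K) :
    tmk x y <• k = tmk x (y <• k) := rfl

theorem tmk_eq {X : Biset G H} {Y : Biset H K} {x x' : X} {y y' : Y} :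
    tmk x y = tmk x' y' ↔ ∃ h : H, x = x' <• h ∧ h • y = y' := by
  constructor
  · intro e
    obtain ⟨h, e⟩ := Quotient.exact e
    simp only [Prod.mk.injEq] at e
    refine ⟨h, ?_, e.2.symm⟩
    rw [e.1]
    simp
  · rintro ⟨h, rfl, rfl⟩
    refine Quotient.sound ⟨h, ?_⟩
    simp

theorem tmk_surj {X : Biset G H} {Y : Biset H K} (z : tensor X Y) : ∃ x y, z = tmk x y := by
  obtain ⟨⟨x, y⟩, rfl⟩ := Quotient.exists_rep z
  exact ⟨x, y, rfl⟩

theorem tmk_balanced {X : Biset G H} {Y : Biset H K} (x : X) (h : H) (y : Y) :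
    tmk (x <• h) y = tmk x (h • y) := tmk_eq.2 ⟨h, rfl, rfl⟩

/-- The universal property of `X ×_H Y` as a set. -/
def tlift {X : Biset G H} {Y : Biset H K} {Z : Type*} (f : X → Y → Z)
    (hf : ∀ (x : X) (h : H) (y : Y), f (x <• h) y = f x (h • y)) : tensor X Y → Z :=
  Quotient.lift (fun p => f p.1 p.2) (by
    rintro ⟨x, y⟩ q ⟨h, rfl⟩
    have := hf (x <• h⁻¹) h y
    simpa using this)

theorem tlift_tmk {X : Biset G H} {Y : Biset H K} {Z : Type*} (f : X → Y → Z)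
    (hf : ∀ (x : X) (h : H) (y : Y), f (x <• h) y = f x (h • y)) (x : X) (y : Y) :
    tlift f hf (tmk x y) = f x y := rfl

/-- The opposite biset: the same set with `h • x • g = g⁻¹ x h⁻¹`. -/
def opp (X : Biset G H) : Biset H G :=
  ofOps X.carrier (fun h x => x <• h⁻¹) (fun x g => g⁻¹ • x)
    (fun x => by simp) (fun h h' x => by simp [mul_smul])
    (fun x => by simp) (fun x g g' => by simp [mul_smul])
    (fun h x g => (smul_comm _ _ _).symm)

/-- The transitive biset `G × H / L`, with `g • (a, b)L • h = (g a, h⁻¹ b)L`. -/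
def coset [Finite G] [Finite H] (L : Subgroup (G × H)) : Biset G H :=
  ofOps ((G × H) ⧸ L) (fun g x => ((g, 1) : G × H) • x) (fun x h => ((1, h⁻¹) : G × H) • x)
    (fun x => one_smul (G × H) x)
    (fun g g' x => by simp [← mul_smul])
    (fun x => by rw [inv_one]; exact one_smul (G × H) x)
    (fun x h h' => by simp [← mul_smul])
    (fun g x h => by simp [← mul_smul])

/-- The set `Q` with the `(G, H)`-action `g • x • h = a(g) x b(h)` for homomorphisms
`a : G → Q` and `b : H → Q`. -/
def ofHoms {Q : Type u} [Group Q] [Finite Q] (a : G →* Q) (b : H →* Q) : Biset G H :=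
  ofOps Q (fun g x => a g * x) (fun x h => x * b h) (fun x => by simp)
    (fun g g' x => by simp [mul_assoc]) (fun x => by simp)
    (fun x h h' => by simp [mul_assoc]) (fun g x h => by simp [mul_assoc])

/-- The identity biset `G`, with left and right multiplication. -/
def identity (G : Type u) [Group G] [Finite G] : Biset G G :=
  ofHoms (MonoidHom.id G) (MonoidHom.id G)

/-- Inflation from `G ⧸ N` to `G`: the set `G ⧸ N` as a `(G, G ⧸ N)`-biset. -/
def inf [Finite G] (N : Subgroup G) [N.Normal] : Biset G (G ⧸ N) :=
  ofHoms (QuotientGroup.mk' N) (MonoidHom.id (G ⧸ N))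

/-- Deflation from `G` to `G ⧸ N`: the set `G ⧸ N` as a `(G ⧸ N, G)`-biset. -/
def defl [Finite G] (N : Subgroup G) [N.Normal] : Biset (G ⧸ N) G :=
  ofHoms (MonoidHom.id (G ⧸ N)) (QuotientGroup.mk' N)

/-! ### Isomorphisms between bisets -/

theorem sum_congr {X X' Y Y' : Biset G H} : Iso X X' → Iso Y Y' → Iso (sum X Y) (sum X' Y') := by
  rintro ⟨e, h1, h2⟩ ⟨f, k1, k2⟩
  refine ⟨Equiv.sumCongr e f, ?_, ?_⟩
  · rintro g (x | y)
    · exact congrArg Sum.inl (h1 g x)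
    · exact congrArg Sum.inr (k1 g y)
  · rintro (x | y) h
    · exact congrArg Sum.inl (h2 x h)
    · exact congrArg Sum.inr (k2 y h)

theorem sum_comm_iso (X Y : Biset G H) : Iso (sum X Y) (sum Y X) := by
  refine ⟨Equiv.sumComm X Y, ?_, ?_⟩
  · rintro g (x | y) <;> rfl
  · rintro (x | y) h <;> rfl

theorem sum_assoc_iso (X Y Z : Biset G H) : Iso (sum (sum X Y) Z) (sum X (sum Y Z)) := by
  refine ⟨Equiv.sumAssoc X Y Z, ?_, ?_⟩
  · rintro g ((x | y) | z) <;> rfl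
  · rintro ((x | y) | z) h <;> rfl

theorem empty_sum_iso (X : Biset G H) : Iso (sum (empty G H) X) X := by
  refine ⟨Equiv.emptySum PEmpty X, ?_, ?_⟩
  · rintro g (x | y)
    · exact x.elim
    · rfl
  · rintro (x | y) h
    · exact x.elim
    · rfl

theorem tensor_congr {X X' : Biset G H} {Y Y' : Biset H K} :
    Iso X X' → Iso Y Y' → Iso (tensor X Y) (tensor X' Y') := by
  rintro ⟨e, h1, h2⟩ ⟨f, k1, k2⟩
  refine Iso.of_bijective (tlift (fun x y => tmk (e x) (f y)) ?_) ⟨?_, ?_⟩ ?_ ?_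
  · intro x h y
    rw [h2, k1, tmk_balanced]
  · intro z w hzw
    obtain ⟨x, y, rfl⟩ := tmk_surj z
    obtain ⟨x', y', rfl⟩ := tmk_surj w
    rw [tlift_tmk, tlift_tmk, tmk_eq] at hzw
    obtain ⟨h, hx, hy⟩ := hzw
    rw [← h2] at hx
    rw [← k1] at hy
    exact tmk_eq.2 ⟨h, e.injective hx, f.injective hy⟩
  · intro z
    obtain ⟨x, y, rfl⟩ := tmk_surj z
    exact ⟨tmk (e.symm x) (f.symm y), by simp [tlift_tmk]⟩
  · intro g z
    obtain ⟨x, y, rfl⟩ := tmk_surj z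
    simp [tlift_tmk, smul_tmk, h1]
  · intro z k
    obtain ⟨x, y, rfl⟩ := tmk_surj z
    simp [tlift_tmk, tmk_smul, k2]

theorem tensor_assoc_iso (X : Biset G H) (Y : Biset H K) (Z : Biset K L) :
    Iso (tensor (tensor X Y) Z) (tensor X (tensor Y Z)) := by
  refine Iso.of_bijective (tlift (tlift (fun x y z => tmk x (tmk y z)) ?_) ?_) ⟨?_, ?_⟩ ?_ ?_
  · intro x h y
    funext z
    rw [tmk_balanced, smul_tmk]
  · intro p k z
    obtain ⟨x, y, rfl⟩ := tmk_surj p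
    rw [tmk_smul, tlift_tmk, tlift_tmk, tmk_balanced]
  · intro p q hpq
    obtain ⟨p, z, rfl⟩ := tmk_surj p
    obtain ⟨x, y, rfl⟩ := tmk_surj p
    obtain ⟨q, z', rfl⟩ := tmk_surj q
    obtain ⟨x', y', rfl⟩ := tmk_surj q
    simp only [tlift_tmk] at hpq
    obtain ⟨h, rfl, hy⟩ := tmk_eq.1 hpq
    rw [smul_tmk] at hy
    obtain ⟨k, hk, rfl⟩ := tmk_eq.1 hy
    rw [tmk_balanced, hk, ← tmk_smul, tmk_balanced]
  · intro p
    obtain ⟨x, q, rfl⟩ := tmk_surj p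
    obtain ⟨y, z, rfl⟩ := tmk_surj q
    exact ⟨tmk (tmk x y) z, rfl⟩
  · intro g p
    obtain ⟨p, z, rfl⟩ := tmk_surj p
    obtain ⟨x, y, rfl⟩ := tmk_surj p
    rfl
  · intro p l
    obtain ⟨p, z, rfl⟩ := tmk_surj p
    obtain ⟨x, y, rfl⟩ := tmk_surj p
    rfl

theorem sum_tensor_iso (X X' : Biset G H) (Y : Biset H K) :
    Iso (tensor (sum X X') Y) (sum (tensor X Y) (tensor X' Y)) := by
  refine Iso.of_bijective (tlift (fun p y => Sum.elim (fun x => (Sum.inl (tmk x y) :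
    (tensor X Y : Type u) ⊕ (tensor X' Y : Type u))) (fun x => Sum.inr (tmk x y)) p) ?_)
    ⟨?_, ?_⟩ ?_ ?_
  · rintro (x | x) h y
    · exact congrArg Sum.inl (tmk_balanced x h y)
    · exact congrArg Sum.inr (tmk_balanced x h y)
  · intro p q hpq
    obtain ⟨x, y, rfl⟩ := tmk_surj p
    obtain ⟨x', y', rfl⟩ := tmk_surj q
    rw [tlift_tmk, tlift_tmk] at hpq
    rcases x with x | x <;> rcases x' with x' | x'
    · obtain ⟨h, hx, hy⟩ := tmk_eq.1 (Sum.inl.inj hpq)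
      exact tmk_eq.2 ⟨h, congrArg Sum.inl hx, hy⟩
    · exact (Sum.inl_ne_inr hpq).elim
    · exact (Sum.inr_ne_inl hpq).elim
    · obtain ⟨h, hx, hy⟩ := tmk_eq.1 (Sum.inr.inj hpq)
      exact tmk_eq.2 ⟨h, congrArg Sum.inr hx, hy⟩
  · rintro (p | p)
    · obtain ⟨x, y, rfl⟩ := tmk_surj p
      exact ⟨tmk (X := sum X X') (Sum.inl x) y, rfl⟩
    · obtain ⟨x, y, rfl⟩ := tmk_surj p
      exact ⟨tmk (X := sum X X') (Sum.inr x) y, rfl⟩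
  · intro g p
    obtain ⟨x | x, y, rfl⟩ := tmk_surj p <;> rfl
  · intro p k
    obtain ⟨x | x, y, rfl⟩ := tmk_surj p <;> rfl

theorem tensor_sum_iso (X : Biset G H) (Y Y' : Biset H K) :
    Iso (tensor X (sum Y Y')) (sum (tensor X Y) (tensor X Y')) := by
  refine Iso.of_bijective (tlift (fun x p => Sum.elim (fun y => (Sum.inl (tmk x y) :
    (tensor X Y : Type u) ⊕ (tensor X Y' : Type u))) (fun y => Sum.inr (tmk x y)) p) ?_)
    ⟨?_, ?_⟩ ?_ ?_
  · rintro x h (y | y)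
    · exact congrArg Sum.inl (tmk_balanced x h y)
    · exact congrArg Sum.inr (tmk_balanced x h y)
  · intro p q hpq
    obtain ⟨x, y, rfl⟩ := tmk_surj p
    obtain ⟨x', y', rfl⟩ := tmk_surj q
    rw [tlift_tmk, tlift_tmk] at hpq
    rcases y with y | y <;> rcases y' with y' | y'
    · obtain ⟨h, hx, hy⟩ := tmk_eq.1 (Sum.inl.inj hpq)
      exact tmk_eq.2 ⟨h, hx, congrArg Sum.inl hy⟩
    · exact (Sum.inl_ne_inr hpq).elim
    · exact (Sum.inr_ne_inl hpq).elim
    · obtain ⟨h, hx, hy⟩ := tmk_eq.1 (Sum.inr.inj hpq)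
      exact tmk_eq.2 ⟨h, hx, congrArg Sum.inr hy⟩
  · rintro (p | p)
    · obtain ⟨x, y, rfl⟩ := tmk_surj p
      exact ⟨tmk (Y := sum Y Y') x (Sum.inl y), rfl⟩
    · obtain ⟨x, y, rfl⟩ := tmk_surj p
      exact ⟨tmk (Y := sum Y Y') x (Sum.inr y), rfl⟩
  · intro g p
    obtain ⟨x, y | y, rfl⟩ := tmk_surj p <;> rfl
  · intro p k
    obtain ⟨x, y | y, rfl⟩ := tmk_surj p <;> rfl

theorem empty_tensor_iso (Y : Biset H K) : Iso (tensor (empty G H) Y) (empty G K) := by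
  have : IsEmpty (tensor (empty G H) Y) := ⟨fun p => by
    obtain ⟨x, y, -⟩ := tmk_surj p
    exact PEmpty.elim x⟩
  have : IsEmpty (empty G K) := inferInstanceAs (IsEmpty PEmpty)
  exact ⟨Equiv.equivOfIsEmpty _ _, fun _ p => isEmptyElim p, fun p _ => isEmptyElim p⟩

theorem tensor_empty_iso (X : Biset G H) : Iso (tensor X (empty H K)) (empty G K) := by
  have : IsEmpty (tensor X (empty H K)) := ⟨fun p => by
    obtain ⟨x, y, -⟩ := tmk_surj p
    exact PEmpty.elim y⟩
  have : IsEmpty (empty G K) := inferInstanceAs (IsEmpty PEmpty)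
  exact ⟨Equiv.equivOfIsEmpty _ _, fun _ p => isEmptyElim p, fun p _ => isEmptyElim p⟩

/-- A product of two sets `ofHoms` in which the middle group acts freely and transitively on one
factor in the middle variable. -/
theorem ofHoms_tensor_iso {Q : Type u} [Group Q] [Finite Q] {R : Type u} [Group R] [Finite R]
    (a : G →* Q) (b : H →* R) (d : K →* R) (c : R →* Q) (hb : Function.Surjective b) :
    Iso (tensor (ofHoms a (c.comp b)) (ofHoms b d)) (ofHoms a (c.comp d)) := by
  refine Iso.of_bijective (tlift (fun (x : Q) (y : R) => (x * c y : Q)) ?_) ⟨?_, ?_⟩ ?_ ?_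
  · intro (x : Q) h (y : R)
    change x * c (b h) * c y = x * c (b h * y)
    simp [mul_assoc]
  · intro p q hpq
    obtain ⟨x, y, rfl⟩ := tmk_surj p
    obtain ⟨x', y', rfl⟩ := tmk_surj q
    change Q at x x'
    change R at y y'
    change x * c y = x' * c y' at hpq
    obtain ⟨h, hh⟩ := hb (y' * y⁻¹)
    refine tmk_eq.2 ⟨h, ?_, ?_⟩
    · change x = x' * c (b h)
      rw [hh, map_mul, ← mul_assoc, ← hpq]
      simp
    · change b h * y = y'
      rw [hh]
      simp
  · intro (x : Q)
    exact ⟨tmk (X := ofHoms a (c.comp b)) (Y := ofHoms b d) x (1 : R),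
      show x * c (1 : R) = x by simp⟩
  · intro g p
    obtain ⟨x, y, rfl⟩ := tmk_surj p
    change Q at x
    change R at y
    change a g * x * c y = a g * (x * c y)
    rw [mul_assoc]
  · intro p k
    obtain ⟨x, y, rfl⟩ := tmk_surj p
    change Q at x
    change R at y
    change x * c (y * d k) = x * c y * c (d k)
    rw [map_mul, mul_assoc]

theorem identity_tensor_iso [Finite G] (X : Biset G H) : Iso (tensor (identity G) X) X := by
  refine Iso.of_bijective (tlift (fun (g : G) (x : X) => g • x) ?_) ⟨?_, ?_⟩ ?_ ?_
  · intro (g : G) h x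
    change (g * h) • x = g • h • x
    rw [mul_smul]
  · intro p q hpq
    obtain ⟨g, x, rfl⟩ := tmk_surj p
    obtain ⟨g', x', rfl⟩ := tmk_surj q
    change G at g g'
    change g • x = g' • x' at hpq
    refine tmk_eq.2 ⟨g'⁻¹ * g, ?_, ?_⟩
    · change g = g' * (g'⁻¹ * g)
      simp
    · rw [mul_smul, hpq, inv_smul_smul]
  · intro x
    exact ⟨tmk (X := identity G) (1 : G) x, one_smul G x⟩
  · intro g p
    obtain ⟨g', x, rfl⟩ := tmk_surj p
    exact mul_smul g (g' : G) x
  · intro p k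
    obtain ⟨g', x, rfl⟩ := tmk_surj p
    exact smul_comm (M := G) g' (MulOpposite.op k) x

theorem opp_congr {X X' : Biset G H} : Iso X X' → Iso (opp X) (opp X') := by
  rintro ⟨e, h1, h2⟩
  exact ⟨e, fun h x => h2 x h⁻¹, fun x g => h1 g⁻¹ x⟩

theorem opp_opp_iso (X : Biset G H) : Iso (opp (opp X)) X := by
  refine ⟨Equiv.refl X, fun g x => ?_, fun x h => ?_⟩
  · exact congrArg (fun k => HSMul.hSMul (α := G) (β := X) k x) (inv_inv g)
  · exact congrArg (fun k => HSMul.hSMul (α := Hᵐᵒᵖ) (β := X) (MulOpposite.op k) x) (inv_inv h)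

theorem opp_sum_iso (X Y : Biset G H) : Iso (opp (sum X Y)) (sum (opp X) (opp Y)) := by
  refine ⟨Equiv.refl (X ⊕ Y), ?_, ?_⟩
  · rintro h (x | x) <;> rfl
  · rintro (x | x) g <;> rfl

theorem opp_empty_iso : Iso (opp (empty G H)) (empty H G) :=
  ⟨Equiv.refl PEmpty, fun _ x => PEmpty.elim x, fun x _ => PEmpty.elim x⟩

theorem opp_tensor_iso (X : Biset G H) (Y : Biset H K) :
    Iso (opp (tensor X Y)) (tensor (opp Y) (opp X)) := by
  refine Iso.symm (Iso.of_bijective (tlift (fun (y : Y) (x : X) => tmk x y) ?_) ⟨?_, ?_⟩ ?_ ?_)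
  · intro (y : Y) h (x : X)
    change tmk x (h⁻¹ • y) = tmk (x <• h⁻¹) y
    rw [tmk_balanced]
  · intro p q hpq
    obtain ⟨y, x, rfl⟩ := tmk_surj p
    obtain ⟨y', x', rfl⟩ := tmk_surj q
    change Y at y y'
    change X at x x'
    change tmk x y = tmk x' y' at hpq
    obtain ⟨h, hx, hy⟩ := tmk_eq.1 hpq
    refine tmk_eq.2 ⟨h, ?_, ?_⟩
    · change y = h⁻¹ • y'
      rw [← hy, inv_smul_smul]
    · change x <• h⁻¹ = x'
      rw [hx]
      simp
  · intro p
    obtain ⟨x, y, rfl⟩ := tmk_surj (X := X) (Y := Y) p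
    exact ⟨tmk (X := opp Y) (Y := opp X) y x, rfl⟩
  · intro g p
    obtain ⟨y, x, rfl⟩ := tmk_surj p
    rfl
  · intro p k
    obtain ⟨y, x, rfl⟩ := tmk_surj p
    rfl

theorem opp_ofHoms_iso {Q : Type u} [Group Q] [Finite Q] (a : G →* Q) (b : H →* Q) :
    Iso (opp (ofHoms a b)) (ofHoms b a) := by
  refine ⟨Equiv.inv Q, fun h x => ?_, fun x g => ?_⟩
  · change Q at x
    change (x * b h⁻¹)⁻¹ = b h * x⁻¹
    simp
  · change Q at x
    change (a g⁻¹ * x)⁻¹ = x⁻¹ * a g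
    simp

end Biset

end Bisets

/-! ### The Burnside group of bisets -/

section Burnside

variable {G H K L : Type u} [Group G] [Group H] [Group K] [Group L]

/-- Isomorphism classes of finite `(G, H)`-bisets. -/
def BisetClass (G H : Type u) [Group G] [Group H] : Type (u + 1) :=
  Quotient (Biset.isoSetoid G H)

/-- The isomorphism class of a biset. -/
def BisetClass.mk (X : Biset G H) : BisetClass G H := Quotient.mk _ X

theorem BisetClass.sound {X Y : Biset G H} (h : Biset.Iso X Y) : mk X = mk Y := Quotient.sound h

/-- Addition of isomorphism classes is disjoint union. -/
instance : Add (BisetClass G H) :=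
  ⟨Quotient.map₂ Biset.sum (fun _ _ h _ _ k => Biset.sum_congr h k)⟩

instance : Zero (BisetClass G H) := ⟨BisetClass.mk (Biset.empty G H)⟩

instance : AddCommMonoid (BisetClass G H) where
  add_assoc := by
    rintro ⟨X⟩ ⟨Y⟩ ⟨Z⟩
    exact BisetClass.sound (Biset.sum_assoc_iso X Y Z)
  zero_add := by
    rintro ⟨X⟩
    exact BisetClass.sound (Biset.empty_sum_iso X)
  add_zero := by
    rintro ⟨X⟩
    exact BisetClass.sound ((Biset.sum_comm_iso _ _).trans (Biset.empty_sum_iso X))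
  add_comm := by
    rintro ⟨X⟩ ⟨Y⟩
    exact BisetClass.sound (Biset.sum_comm_iso X Y)
  nsmul := nsmulRec

theorem BisetClass.mk_sum (X Y : Biset G H) : mk (X.sum Y) = mk X + mk Y := rfl

theorem BisetClass.mk_empty : mk (Biset.empty G H) = 0 := rfl

/-- `B(G, H)`: the Grothendieck group of finite `(G, H)`-bisets under disjoint union. -/
def B (G H : Type u) [Group G] [Group H] : Type (u + 1) :=
  Algebra.GrothendieckAddGroup (BisetClass G H)

instance : AddCommGroup (B G H) :=
  inferInstanceAs (AddCommGroup (Algebra.GrothendieckAddGroup (BisetClass G H)))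

/-- The map from isomorphism classes to the Grothendieck group. -/
def B.of : BisetClass G H →+ B G H :=
  Algebra.GrothendieckAddGroup.of (M := BisetClass G H)

/-- The class `[X]` of a finite biset in `B(G, H)`. -/
def cls (X : Biset G H) : B G H := B.of (BisetClass.mk X)

/-- The universal property of the Grothendieck group. -/
noncomputable def B.lift {A : Type*} [AddCommGroup A] (f : BisetClass G H →+ A) : B G H →+ A :=
  Algebra.GrothendieckAddGroup.lift f

theorem B.lift_of {A : Type*} [AddCommGroup A] (f : BisetClass G H →+ A) (x : BisetClass G H) :
    B.lift f (B.of x) = f x :=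
  DFunLike.congr_fun (Algebra.GrothendieckAddGroup.lift.symm_apply_apply f) x

theorem cls_eq {X Y : Biset G H} (h : Biset.Iso X Y) : cls X = cls Y :=
  congrArg B.of (BisetClass.sound h)

theorem cls_sum (X Y : Biset G H) : cls (X.sum Y) = cls X + cls Y := by
  rw [cls, BisetClass.mk_sum, map_add]
  rfl

theorem cls_empty : cls (Biset.empty G H) = 0 := by
  rw [cls, BisetClass.mk_empty, map_zero]

theorem B.hom_ext {A : Type*} [AddCommGroup A] {f g : B G H →+ A}
    (h : ∀ X, f (cls X) = g (cls X)) : f = g := by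
  apply Algebra.GrothendieckAddGroup.lift.symm.injective
  ext ⟨X⟩
  exact h X

theorem B.closure_cls : AddSubgroup.closure (Set.range (cls (G := G) (H := H))) = ⊤ := by
  have := B.hom_ext (f := QuotientAddGroup.mk' (AddSubgroup.closure (Set.range (cls (G := G)
    (H := H))))) (g := 0) (fun X => (QuotientAddGroup.eq_zero_iff _).2
      (AddSubgroup.subset_closure ⟨X, rfl⟩))
  refine eq_top_iff.2 fun x _ => (QuotientAddGroup.eq_zero_iff x).1 ?_
  exact DFunLike.congr_fun this x

/-- To check an additive statement on `B(G, H)` it suffices to check it on bisets. -/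
theorem B.induction {p : B G H → Prop} (x : B G H) (hc : ∀ X, p (cls X))
    (hadd : ∀ a b, p a → p b → p (a + b)) (hneg : ∀ a, p a → p (-a)) : p x := by
  have hx : x ∈ AddSubgroup.closure (Set.range (cls (G := G) (H := H))) := by
    rw [B.closure_cls]
    trivial
  induction hx using AddSubgroup.closure_induction with
  | mem x h =>
    obtain ⟨X, rfl⟩ := h
    exact hc X
  | zero =>
    rw [← cls_empty]
    exact hc _
  | add a b _ _ ha hb => exact hadd a b ha hb
  | neg a _ ha => exact hneg a ha

/-- The additive map on isomorphism classes induced by an additive invariant of bisets. -/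
def BisetClass.liftHom {A : Type*} [AddCommMonoid A] (f : Biset G H → A)
    (hf : ∀ X Y, Biset.Iso X Y → f X = f Y) (h0 : f (Biset.empty G H) = 0)
    (hs : ∀ X Y, f (X.sum Y) = f X + f Y) : BisetClass G H →+ A where
  toFun := Quotient.lift f hf
  map_zero' := h0
  map_add' := by
    rintro ⟨X⟩ ⟨Y⟩
    exact hs X Y

/-- The homomorphism on `B(G, H)` induced by an additive invariant of bisets. -/
noncomputable def B.liftBiset {A : Type*} [AddCommGroup A] (f : Biset G H → A)
    (hf : ∀ X Y, Biset.Iso X Y → f X = f Y) (h0 : f (Biset.empty G H) = 0)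
    (hs : ∀ X Y, f (X.sum Y) = f X + f Y) : B G H →+ A :=
  B.lift (BisetClass.liftHom f hf h0 hs)

theorem B.liftBiset_cls {A : Type*} [AddCommGroup A] (f : Biset G H → A)
    (hf : ∀ X Y, Biset.Iso X Y → f X = f Y) (h0 : f (Biset.empty G H) = 0)
    (hs : ∀ X Y, f (X.sum Y) = f X + f Y) (X : Biset G H) :
    B.liftBiset f hf h0 hs (cls X) = f X :=
  B.lift_of _ _

/-- The bilinear map `B(G, H) × B(H, K) → B(G, K)` with `[X] ∘ [Y] = [X ×_H Y]`. -/
noncomputable def compHom : B G H →+ B H K →+ B G K :=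
  B.liftBiset
    (fun X => B.liftBiset (fun Y => cls (X.tensor Y))
      (fun _ _ h => cls_eq (Biset.tensor_congr (Biset.Iso.refl X) h))
      ((cls_eq (Biset.tensor_empty_iso X)).trans cls_empty)
      (fun Y Y' => (cls_eq (Biset.tensor_sum_iso X Y Y')).trans (cls_sum _ _)))
    (fun X X' h => B.hom_ext fun Y => by
      rw [B.liftBiset_cls, B.liftBiset_cls]
      exact cls_eq (Biset.tensor_congr h (Biset.Iso.refl Y)))
    (B.hom_ext fun Y => by
      rw [B.liftBiset_cls]
      exact (cls_eq (Biset.empty_tensor_iso Y)).trans cls_empty)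
    (fun X X' => B.hom_ext fun Y => by
      rw [AddMonoidHom.add_apply, B.liftBiset_cls, B.liftBiset_cls, B.liftBiset_cls]
      exact (cls_eq (Biset.sum_tensor_iso X X' Y)).trans (cls_sum _ _))

/-- Composition `a ∘_H b`. -/
noncomputable def comp (a : B G H) (b : B H K) : B G K := compHom a b

theorem comp_cls (X : Biset G H) (Y : Biset H K) : comp (cls X) (cls Y) = cls (X.tensor Y) := by
  rw [comp, compHom, B.liftBiset_cls, B.liftBiset_cls]

theorem add_comp (a a' : B G H) (b : B H K) : comp (a + a') b = comp a b + comp a' b := by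
  simp [comp]

theorem comp_add (a : B G H) (b b' : B H K) : comp a (b + b') = comp a b + comp a b' := by
  simp [comp]

theorem neg_comp (a : B G H) (b : B H K) : comp (-a) b = -comp a b := by
  simp [comp]

theorem comp_neg (a : B G H) (b : B H K) : comp a (-b) = -comp a b := by
  simp [comp]

theorem comp_sub (a : B G H) (b b' : B H K) : comp a (b - b') = comp a b - comp a b' := by
  simp [comp]

theorem sub_comp (a a' : B G H) (b : B H K) : comp (a - a') b = comp a b - comp a' b := by
  simp [comp]

theorem comp_assoc (a : B G H) (b : B H K) (c : B K L) :
    comp (comp a b) c = comp a (comp b c) := by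
  induction a using B.induction with
  | hadd a a' h h' => simp only [add_comp, h, h']
  | hneg a h => simp only [neg_comp, h]
  | hc X =>
    induction b using B.induction with
    | hadd a a' h h' => simp only [add_comp, comp_add, h, h']
    | hneg a h => simp only [neg_comp, comp_neg, h]
    | hc Y =>
      induction c using B.induction with
      | hadd a a' h h' => simp only [comp_add, h, h']
      | hneg a h => simp only [comp_neg, h]
      | hc Z =>
        simp only [comp_cls]
        exact cls_eq (Biset.tensor_assoc_iso X Y Z)

/-- The additive map `B(G, H) → B(H, G)` with `[X]° = [X°]`. -/
noncomputable def dual : B G H →+ B H G :=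
  B.liftBiset (fun X => cls X.opp) (fun _ _ h => cls_eq (Biset.opp_congr h))
    ((cls_eq Biset.opp_empty_iso).trans cls_empty)
    (fun X Y => (cls_eq (Biset.opp_sum_iso X Y)).trans (cls_sum _ _))

theorem dual_cls (X : Biset G H) : dual (cls X) = cls X.opp := B.liftBiset_cls _ _ _ _ X

theorem dual_dual (a : B G H) : dual (dual a) = a := by
  induction a using B.induction with
  | hadd a b ha hb => rw [map_add, map_add, ha, hb]
  | hneg a ha => rw [map_neg, map_neg, ha]
  | hc X =>
    rw [dual_cls, dual_cls]
    exact cls_eq (Biset.opp_opp_iso X)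

theorem dual_comp (a : B G H) (b : B H K) : dual (comp a b) = comp (dual b) (dual a) := by
  induction a using B.induction with
  | hadd a a' h h' => simp only [add_comp, comp_add, map_add, h, h']
  | hneg a h => simp only [neg_comp, comp_neg, map_neg, h]
  | hc X =>
    induction b using B.induction with
    | hadd a a' h h' => simp only [add_comp, comp_add, map_add, h, h']
    | hneg a h => simp only [neg_comp, comp_neg, map_neg, h]
    | hc Y =>
      simp only [comp_cls, dual_cls]
      exact cls_eq (Biset.opp_tensor_iso X Y)

theorem id_comp [Finite G] (a : B G H) : comp (cls (Biset.identity G)) a = a := by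
  induction a using B.induction with
  | hadd a a' h h' => rw [comp_add, h, h']
  | hneg a h => rw [comp_neg, h]
  | hc X =>
    rw [comp_cls]
    exact cls_eq (Biset.identity_tensor_iso X)

theorem dual_id [Finite G] : dual (cls (Biset.identity G)) = cls (Biset.identity G) := by
  rw [dual_cls]
  exact cls_eq (Biset.opp_ofHoms_iso _ _)

theorem comp_id [Finite H] (a : B G H) : comp a (cls (Biset.identity H)) = a := by
  rw [← dual_dual (comp a _), dual_comp, dual_id, id_comp, dual_dual]

/-- The double Burnside ring `B(G, G)`, with multiplication `∘_G` and identity `[G]`. -/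
noncomputable instance [Finite G] : Ring (B G G) where
  __ := (inferInstance : AddCommGroup (B G G))
  mul := comp
  one := cls (Biset.identity G)
  mul_assoc := comp_assoc
  one_mul := id_comp
  mul_one := comp_id
  left_distrib := comp_add
  right_distrib := add_comp
  zero_mul a := by
    change comp 0 a = 0
    simp [comp]
  mul_zero a := by
    change comp a 0 = 0
    simp [comp]

theorem mul_def [Finite G] (a b : B G G) : a * b = comp a b := rfl

theorem one_def [Finite G] : (1 : B G G) = cls (Biset.identity G) := rfl

theorem dual_mul [Finite G] (a b : B G G) : dual (a * b) = dual b * dual a := dual_comp a b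

theorem dual_one [Finite G] : dual (1 : B G G) = 1 := dual_id

/-- `B_∘(G, G)`: the group of orthogonal units, `u u° = u° u = Id_G`. -/
noncomputable def orthogonalUnits (G : Type u) [Group G] [Finite G] : Subgroup (B G G)ˣ where
  carrier := {u | (u : B G G) * dual (u : B G G) = 1 ∧ dual (u : B G G) * (u : B G G) = 1}
  one_mem' := by simp [dual_one]
  mul_mem' := by
    rintro u v ⟨h1, h2⟩ ⟨k1, k2⟩
    constructor
    · rw [Units.val_mul, dual_mul, mul_assoc, ← mul_assoc (v : B G G), k1, one_mul, h1]
    · rw [Units.val_mul, dual_mul, mul_assoc, ← mul_assoc _ (u : B G G), h2, one_mul, k2]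
  inv_mem' := by
    rintro u ⟨h1, h2⟩
    have h : ((u⁻¹ : (B G G)ˣ) : B G G) = dual (u : B G G) :=
      Units.inv_eq_of_mul_eq_one_right h1
    constructor
    · rw [h, dual_dual, h2]
    · rw [h, dual_dual, h1]

/-! ### Inflation of units -/

section Inflation

variable [Finite G] (N : Subgroup G) [N.Normal]

theorem defl_comp_inf : comp (cls (Biset.defl N)) (cls (Biset.inf N)) = 1 := by
  rw [comp_cls]
  exact cls_eq (Biset.ofHoms_tensor_iso (MonoidHom.id (G ⧸ N)) (QuotientGroup.mk' N)
    (MonoidHom.id (G ⧸ N)) (MonoidHom.id (G ⧸ N)) (QuotientGroup.mk'_surjective N))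

theorem dual_inf : dual (cls (Biset.inf N)) = cls (Biset.defl N) := by
  rw [dual_cls]
  exact cls_eq (Biset.opp_ofHoms_iso _ _)

theorem dual_defl : dual (cls (Biset.defl N)) = cls (Biset.inf N) := by
  rw [dual_cls]
  exact cls_eq (Biset.opp_ofHoms_iso _ _)

/-- The map `a ↦ Inf ∘ a ∘ Def` from `B(G ⧸ N, G ⧸ N)` to `B(G, G)`. -/
noncomputable def inflate (a : B (G ⧸ N) (G ⧸ N)) : B G G :=
  comp (comp (cls (Biset.inf N)) a) (cls (Biset.defl N))

theorem inflate_mul (a b : B (G ⧸ N) (G ⧸ N)) :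
    inflate N (a * b) = inflate N a * inflate N b := by
  simp only [inflate, mul_def, comp_assoc]
  rw [← comp_assoc (cls (Biset.defl N)), defl_comp_inf, one_def, id_comp]

theorem inflate_add (a b : B (G ⧸ N) (G ⧸ N)) :
    inflate N (a + b) = inflate N a + inflate N b := by
  simp only [inflate, comp_add, add_comp]

theorem inflate_sub (a b : B (G ⧸ N) (G ⧸ N)) :
    inflate N (a - b) = inflate N a - inflate N b := by
  simp only [inflate, comp_sub, sub_comp]

theorem dual_inflate (a : B (G ⧸ N) (G ⧸ N)) :
    dual (inflate N a) = inflate N (dual a) := by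
  simp only [inflate, dual_comp, dual_inf, dual_defl, comp_assoc]

/-- The map `u ↦ Id_G + Inf ∘ (u - Id_{G/N}) ∘ Def`. -/
noncomputable def inflateUnit (u : B (G ⧸ N) (G ⧸ N)) : B G G := 1 + inflate N (u - 1)

theorem inflateUnit_mul (u v : B (G ⧸ N) (G ⧸ N)) :
    inflateUnit N (u * v) = inflateUnit N u * inflateUnit N v := by
  have h : u * v - 1 = (u - 1) * (v - 1) + (u - 1) + (v - 1) := by noncomm_ring
  simp only [inflateUnit]
  rw [h, inflate_add, inflate_add, inflate_mul]
  noncomm_ring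

theorem inflateUnit_one : inflateUnit N 1 = 1 := by
  simp [inflateUnit, inflate, comp]

theorem dual_inflateUnit (u : B (G ⧸ N) (G ⧸ N)) :
    dual (inflateUnit N u) = inflateUnit N (dual u) := by
  simp only [inflateUnit, map_add, map_sub, dual_one, dual_inflate]

/-- `dBInf : B(G ⧸ N, G ⧸ N)ˣ → B(G, G)ˣ`, `u ↦ Id_G + Inf ∘ (u - Id_{G/N}) ∘ Def`. -/
noncomputable def dBInf : (B (G ⧸ N) (G ⧸ N))ˣ →* (B G G)ˣ :=
  Units.map
    { toFun := inflateUnit N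
      map_one' := inflateUnit_one N
      map_mul' := inflateUnit_mul N }

theorem dBInf_mem {u : (B (G ⧸ N) (G ⧸ N))ˣ} (hu : u ∈ orthogonalUnits (G ⧸ N)) :
    dBInf N u ∈ orthogonalUnits G := by
  obtain ⟨h1, h2⟩ := hu
  constructor
  · change inflateUnit N u * dual (inflateUnit N u) = 1
    rw [dual_inflateUnit, ← inflateUnit_mul, h1, inflateUnit_one]
  · change dual (inflateUnit N u) * inflateUnit N u = 1
    rw [dual_inflateUnit, ← inflateUnit_mul, h2, inflateUnit_one]

/-- The restriction `dBInf : B_∘(G ⧸ N, G ⧸ N) → B_∘(G, G)`. -/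
noncomputable def dBInfOrth : orthogonalUnits (G ⧸ N) →* orthogonalUnits G :=
  ((dBInf N).comp (orthogonalUnits (G ⧸ N)).subtype).codRestrict (orthogonalUnits G)
    (fun u => dBInf_mem N u.2)

end Inflation

/-! ### The ideal `I_G` -/

/-- `I_G`: the subgroup of `B(G, G)` spanned by the `[G × G / M]` with
`|P₁(M) / K₁(M)| = |P₂(M) / K₂(M)| < |G|`, where `P₁`, `P₂` are the projections of `M` and
`K₁(M) = {g | (g, 1) ∈ M}`, `K₂(M) = {h | (1, h) ∈ M}`. -/
noncomputable def idealI (G : Type u) [Group G] [Finite G] : AddSubgroup (B G G) :=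
  AddSubgroup.closure {a | ∃ M : Subgroup (G × G),
    M.goursatFst.relIndex (M.map (MonoidHom.fst G G)) =
      M.goursatSnd.relIndex (M.map (MonoidHom.snd G G)) ∧
    M.goursatFst.relIndex (M.map (MonoidHom.fst G G)) < Nat.card G ∧ a = cls (Biset.coset M)}

end Burnside

/-! ### The maps `ρ` and `η` -/

section Rho

variable {G : Type u} [Group G]

instance : (MulAut.conj : G →* MulAut G).range.Normal where
  conj_mem := by
    rintro _ ⟨g, rfl⟩ f
    refine ⟨f g, ?_⟩
    ext x
    simp

/-- The outer automorphism group `Out(G) = Aut(G) / Inn(G)`. -/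
abbrev Out (G : Type u) [Group G] : Type u := MulAut G ⧸ (MulAut.conj : G →* MulAut G).range

/-- The class of an automorphism in `Out(G)`. -/
def outMk (φ : MulAut G) : Out G := QuotientGroup.mk φ

theorem outMk_mul (φ ψ : MulAut G) : outMk (φ * ψ) = outMk φ * outMk ψ := rfl

theorem outMk_conj (a : G) : outMk (MulAut.conj a) = 1 :=
  (QuotientGroup.eq_one_iff _).2 ⟨a, rfl⟩

namespace Biset

/-- The stabilizer of `x` in `G × G`, `{(g, h) | g x h⁻¹ = x}`, is the subgroup
`Δ_φ(G) = {(g, h) | g = φ h}`. -/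
def HasGraph (X : Biset G G) (x : X) (φ : MulAut G) : Prop :=
  ∀ g h : G, g • x = x <• h ↔ g = φ h

/-- The points of `X` whose stabilizer is `Δ_φ(G)` for some `φ`, together with this `φ`. -/
def GraphPoint (X : Biset G G) : Type u := {p : X × MulAut G // X.HasGraph p.1 p.2}

/-- Two such points are related if they lie in the same `(G, G)`-orbit. -/
def graphSetoid (X : Biset G G) : Setoid X.GraphPoint where
  r p q := ∃ a b : G, q.1.1 = (a • p.1.1) <• b
  iseqv :=
    { refl := fun p => ⟨1, 1, by simp⟩
      symm := by
        rintro ⟨⟨x, φ⟩, hx⟩ ⟨⟨y, ψ⟩, hy⟩ ⟨a, b, h⟩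
        refine ⟨a⁻¹, b⁻¹, ?_⟩
        change x = (a⁻¹ • y) <• b⁻¹
        change y = _ at h
        rw [h, smul_comm a⁻¹]
        simp
      trans := by
        rintro ⟨⟨x, φ⟩, hx⟩ ⟨⟨y, ψ⟩, hy⟩ ⟨⟨z, χ⟩, hz⟩ ⟨a, b, h⟩ ⟨c, d, k⟩
        refine ⟨c * a, b * d, ?_⟩
        change y = (a • x) <• b at h
        change z = (c • y) <• d at k
        change z = ((c * a) • x) <• (b * d)
        rw [k, h, mul_smul, act_mul, smul_comm c] }

/-- The `(G, G)`-orbits of `X` isomorphic to `G × G / Δ_φ(G)` for some automorphism `φ`. -/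
def GraphOrbit (X : Biset G G) : Type u := Quotient X.graphSetoid

theorem HasGraph.unique {X : Biset G G} {x : X} {φ ψ : MulAut G} (h : X.HasGraph x φ)
    (k : X.HasGraph x ψ) : φ = ψ := by
  ext g
  exact (k _ _).1 ((h _ _).2 rfl)

theorem HasGraph.move {X : Biset G G} {x : X} {φ : MulAut G} (h : X.HasGraph x φ) (a b : G) :
    X.HasGraph ((a • x) <• b) (MulAut.conj a * φ * MulAut.conj b) := by
  intro g k
  have e1 : g • ((a • x) <• b) = ((a * (a⁻¹ * g * a)) • x) <• b := by
    rw [smul_comm g, ← mul_smul]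
    congr 2
    group
  have e2 : ((a • x) <• b) <• k = (a • (x <• (b * k * b⁻¹))) <• b := by
    have e3 : b * k * b⁻¹ * b = b * k := by group
    rw [← act_mul, smul_comm a, ← act_mul, e3]
  rw [e1, e2, (MulAction.injective (MulOpposite.op b)).eq_iff, mul_smul,
    (MulAction.injective a).eq_iff, h]
  simp only [MulAut.mul_apply, MulAut.conj_apply]
  constructor
  · intro e
    rw [← e]
    group
  · intro e
    rw [e]
    group

/-- The class in `Out(G)` of the automorphism attached to an orbit. -/
def GraphOrbit.out {X : Biset G G} : X.GraphOrbit → Out G :=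
  Quotient.lift (fun p => outMk p.1.2) (by
    rintro ⟨⟨x, φ⟩, hx⟩ ⟨⟨y, ψ⟩, hy⟩ ⟨a, b, h⟩
    change y = (a • x) <• b at h
    subst h
    change outMk φ = outMk ψ
    have e : ψ = MulAut.conj a * φ * MulAut.conj b := HasGraph.unique hy (HasGraph.move hx a b)
    rw [e, outMk_mul, outMk_mul, outMk_conj, outMk_conj,
      one_mul, mul_one])

/-- The orbit of a point. -/
def gmk {X : Biset G G} (x : X) (φ : MulAut G) (h : X.HasGraph x φ) : X.GraphOrbit :=
  Quotient.mk X.graphSetoid ⟨(x, φ), h⟩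

theorem gmk_out {X : Biset G G} (x : X) (φ : MulAut G) (h : X.HasGraph x φ) :
    (gmk x φ h).out = outMk φ := rfl

theorem gmk_eq {X : Biset G G} {x y : X} {φ ψ : MulAut G} {h : X.HasGraph x φ}
    {k : X.HasGraph y ψ} : gmk x φ h = gmk y ψ k ↔ ∃ a b : G, y = (a • x) <• b :=
  ⟨fun e => Quotient.exact e, fun e => Quotient.sound e⟩

theorem gmk_surj {X : Biset G G} (o : X.GraphOrbit) : ∃ x φ h, o = gmk x φ h := by
  obtain ⟨⟨⟨x, φ⟩, h⟩, rfl⟩ := Quotient.exists_rep o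
  exact ⟨x, φ, h, rfl⟩

instance [Finite G] (X : Biset G G) : Finite X.GraphOrbit := by
  have : Finite (MulAut G) := Finite.of_injective (fun φ : MulAut G => (φ : G → G)) DFunLike.coe_injective
  have : Finite X.GraphPoint := inferInstanceAs (Finite {p : X × MulAut G // X.HasGraph p.1 p.2})
  exact inferInstanceAs (Finite (Quotient X.graphSetoid))

/-- The value of `ρ` on a biset: the sum over the `(G, G)`-orbits `ω` of `X`, where `ω` contributes
`φ̄` if `ω ≅ G × G / Δ_φ(G)` and all other orbits contribute `0`. -/
noncomputable def rho (X : Biset G G) : MonoidAlgebra ℤ (Out G) :=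
  ∑ᶠ o : X.GraphOrbit, MonoidAlgebra.of ℤ (Out G) o.out

theorem rho_congr {X Y : Biset G G} : Iso X Y → rho X = rho Y := by
  rintro ⟨e, h1, h2⟩
  have key : ∀ (x : X) (φ : MulAut G), X.HasGraph x φ → Y.HasGraph (e x) φ := by
    intro x φ h g k
    rw [← h1, ← h2, e.injective.eq_iff, h]
  have key' : ∀ (x : X) (φ : MulAut G), Y.HasGraph (e x) φ → X.HasGraph x φ := by
    intro x φ h g k
    rw [← e.injective.eq_iff, h1, h2, h]
  refine finsum_eq_of_bijective (Quotient.map (fun p => ⟨(e p.1.1, p.1.2), key _ _ p.2⟩) ?_) ?_ ?_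
  · rintro ⟨⟨x, φ⟩, hx⟩ ⟨⟨y, ψ⟩, hy⟩ ⟨a, b, h⟩
    refine ⟨a, b, ?_⟩
    change y = (a • x) <• b at h
    change e y = (a • e x) <• b
    rw [h, h2, h1]
  · constructor
    · intro o o' ho
      obtain ⟨x, φ, h, rfl⟩ := gmk_surj o
      obtain ⟨x', φ', h', rfl⟩ := gmk_surj o'
      obtain ⟨a, b, hab⟩ := gmk_eq.1 ho
      refine gmk_eq.2 ⟨a, b, e.injective ?_⟩
      rw [h2, h1]
      exact hab
    · intro o
      obtain ⟨y, φ, h, rfl⟩ := gmk_surj o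
      have hk : X.HasGraph (e.symm y) φ := key' _ _ (by rwa [e.apply_symm_apply])
      exact ⟨gmk (e.symm y) φ hk, gmk_eq.2 ⟨1, 1, by simp⟩⟩
  · intro o
    obtain ⟨x, φ, h, rfl⟩ := gmk_surj o
    rfl

theorem rho_empty : rho (empty G G) = 0 := by
  have : IsEmpty (empty G G).GraphOrbit := ⟨fun o => by
    obtain ⟨x, -⟩ := gmk_surj o
    exact PEmpty.elim x⟩
  exact finsum_of_isEmpty _

theorem hasGraph_inl {X Y : Biset G G} (x : X) (φ : MulAut G) :
    (X.sum Y).HasGraph (Sum.inl x) φ ↔ X.HasGraph x φ :=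
  forall_congr' fun _ => forall_congr' fun _ => iff_congr Sum.inl_injective.eq_iff Iff.rfl

theorem hasGraph_inr {X Y : Biset G G} (y : Y) (φ : MulAut G) :
    (X.sum Y).HasGraph (Sum.inr y) φ ↔ Y.HasGraph y φ :=
  forall_congr' fun _ => forall_congr' fun _ => iff_congr Sum.inr_injective.eq_iff Iff.rfl

/-- The orbits of a disjoint union. -/
def sumOrbit (X Y : Biset G G) : X.GraphOrbit ⊕ Y.GraphOrbit → (X.sum Y).GraphOrbit :=
  Sum.elim
    (Quotient.map (fun p => ⟨(Sum.inl p.1.1, p.1.2), (hasGraph_inl _ _).2 p.2⟩)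
      (fun _ _ ⟨a, b, h⟩ => ⟨a, b, congrArg Sum.inl h⟩))
    (Quotient.map (fun p => ⟨(Sum.inr p.1.1, p.1.2), (hasGraph_inr _ _).2 p.2⟩)
      (fun _ _ ⟨a, b, h⟩ => ⟨a, b, congrArg Sum.inr h⟩))

theorem sumOrbit_bijective (X Y : Biset G G) : Function.Bijective (sumOrbit X Y) := by
  constructor
  · rintro (o | o) (o' | o') ho
    all_goals
      obtain ⟨x, φ, h, rfl⟩ := gmk_surj o
      obtain ⟨x', φ', h', rfl⟩ := gmk_surj o'
      obtain ⟨a, b, hab⟩ := gmk_eq.1 ho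
    · exact congrArg Sum.inl (gmk_eq.2 ⟨a, b, Sum.inl_injective hab⟩)
    · exact (Sum.inr_ne_inl hab).elim
    · exact (Sum.inl_ne_inr hab).elim
    · exact congrArg Sum.inr (gmk_eq.2 ⟨a, b, Sum.inr_injective hab⟩)
  · intro o
    obtain ⟨x | y, φ, h, rfl⟩ := gmk_surj o
    · exact ⟨Sum.inl (gmk x φ ((hasGraph_inl _ _).1 h)), rfl⟩
    · exact ⟨Sum.inr (gmk y φ ((hasGraph_inr _ _).1 h)), rfl⟩

theorem rho_sum [Finite G] (X Y : Biset G G) : rho (X.sum Y) = rho X + rho Y := by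
  have := Fintype.ofFinite X.GraphOrbit
  have := Fintype.ofFinite Y.GraphOrbit
  have e : rho (X.sum Y) = ∑ᶠ o : X.GraphOrbit ⊕ Y.GraphOrbit,
      MonoidAlgebra.of ℤ (Out G) (sumOrbit X Y o).out :=
    (finsum_eq_of_bijective _ (sumOrbit_bijective X Y) fun _ => rfl).symm
  rw [e, rho, rho, finsum_eq_sum_of_fintype, finsum_eq_sum_of_fintype, finsum_eq_sum_of_fintype,
    Fintype.sum_sum_type]
  congr 1
  · refine Finset.sum_congr rfl fun o _ => ?_
    obtain ⟨x, φ, h, rfl⟩ := gmk_surj o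
    rfl
  · refine Finset.sum_congr rfl fun o _ => ?_
    obtain ⟨x, φ, h, rfl⟩ := gmk_surj o
    rfl

theorem HasGraph.tmk {X Y : Biset G G} {x : X} {y : Y} {φ ψ : MulAut G} (hx : X.HasGraph x φ)
    (hy : Y.HasGraph y ψ) : (X.tensor Y).HasGraph (tmk x y) (φ * ψ) := by
  intro g k
  rw [smul_tmk, tmk_smul, tmk_eq]
  constructor
  · rintro ⟨h, h1, h2⟩
    rw [MulAut.mul_apply, ← (hy _ _).1 h2, ← (hx _ _).1 h1]
  · intro e
    exact ⟨ψ k, (hx _ _).2 e, (hy _ _).2 rfl⟩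

/-- A point of a tensor product with stabilizer `Δ_χ(G)` comes from two such points. -/
theorem HasGraph.of_tmk [Finite G] {X Y : Biset G G} {x : X} {y : Y} {χ : MulAut G}
    (hxy : (X.tensor Y).HasGraph (Biset.tmk x y) χ) :
    ∃ φ ψ : MulAut G, X.HasGraph x φ ∧ Y.HasGraph y ψ := by
  have h0 : ∀ k, ∃ h : G, χ k • x = x <• h ∧ h • y = y <• k := fun k => by
    have := (hxy (χ k) k).2 rfl
    rw [smul_tmk, tmk_smul, tmk_eq] at this
    exact this
  choose f hf1 hf2 using h0
  have hx1 : ∀ g : G, g • x = x → g = 1 := fun g hg => by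
    have : g • Biset.tmk x y = Biset.tmk x y <• (1 : G) := by rw [smul_tmk, hg]; simp
    rw [(hxy _ _).1 this, map_one]
  have hy1 : ∀ k : G, y <• k = y → k = 1 := fun k hk => by
    have : (1 : G) • Biset.tmk x y = Biset.tmk x y <• k := by rw [tmk_smul, hk]; simp
    have := (hxy _ _).1 this
    rwa [eq_comm, map_eq_one_iff χ χ.injective] at this
  have hy2 : ∀ k k' : G, y <• k = y <• k' → k = k' := fun k k' h => by
    have : y <• (k * k'⁻¹) = y := by rw [act_mul, h, ← act_mul]; simp
    exact mul_inv_eq_one.1 (hy1 _ this)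
  have hx2 : ∀ g g' : G, g • x = g' • x → g = g' := fun g g' h => by
    have : (g'⁻¹ * g) • x = x := by rw [mul_smul, h, ← mul_smul]; simp
    exact (inv_mul_eq_one.1 (hx1 _ this)).symm
  have hinj : Function.Injective f := fun k k' h => by
    apply hy2
    rw [← hf2, ← hf2, h]
  have hbij : Function.Bijective f := Finite.injective_iff_bijective.1 hinj
  have hfy : ∀ h k, h • y = y <• k ↔ h = f k := fun h k => by
    constructor
    · intro e
      obtain ⟨k', rfl⟩ := hbij.2 h
      rw [hf2] at e
      rw [hy2 _ _ e]
    · rintro rfl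
      exact hf2 k
  have hmul : ∀ a b, f (a * b) = f a * f b := fun a b => by
    refine ((hfy _ _).1 ?_).symm
    rw [mul_smul, hf2 b, smul_comm, hf2 a, act_mul]
  let ψ : MulAut G := { Equiv.ofBijective f hbij with map_mul' := hmul }
  have hψ : ∀ k, ψ k = f k := fun _ => rfl
  refine ⟨χ * ψ⁻¹, ψ, fun g h => ?_, fun h k => hfy h k⟩
  obtain ⟨k, rfl⟩ := hbij.2 h
  have : (χ * ψ⁻¹) (f k) = χ k := by
    rw [← hψ, MulAut.mul_apply, MulAut.inv_apply_self]
  rw [this, ← hf1]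
  exact ⟨hx2 _ _, fun e => by rw [e]⟩

/-- The orbits of a tensor product. -/
def tensorOrbit (X Y : Biset G G) : X.GraphOrbit × Y.GraphOrbit → (X.tensor Y).GraphOrbit :=
  fun o => Quotient.map₂ (fun p q => ⟨(tmk p.1.1 q.1.1, p.1.2 * q.1.2), p.2.tmk q.2⟩) (by
    rintro ⟨⟨x, φ⟩, hx⟩ ⟨⟨x', φ'⟩, hx'⟩ ⟨a, b, h⟩ ⟨⟨y, ψ⟩, hy⟩ ⟨⟨y', ψ'⟩, hy'⟩ ⟨c, d, k⟩
    change x' = (a • x) <• b at h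
    change y' = (c • y) <• d at k
    change ∃ a b : G, tmk x' y' = (a • tmk x y) <• b
    refine ⟨a * φ (b * c), d, ?_⟩
    rw [h, k, tmk_balanced, smul_tmk, tmk_smul, mul_smul, (hx _ _).2 rfl,
      smul_comm a, tmk_balanced, smul_comm b, smul_comm (b * c), mul_smul]) o.1 o.2

theorem tensorOrbit_bijective [Finite G] (X Y : Biset G G) :
    Function.Bijective (tensorOrbit X Y) := by
  constructor
  · rintro ⟨o1, o2⟩ ⟨o1', o2'⟩ ho
    obtain ⟨x, φ, hx, rfl⟩ := gmk_surj o1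
    obtain ⟨y, ψ, hy, rfl⟩ := gmk_surj o2
    obtain ⟨x', φ', hx', rfl⟩ := gmk_surj o1'
    obtain ⟨y', ψ', hy', rfl⟩ := gmk_surj o2'
    obtain ⟨a, b, hab⟩ := gmk_eq.1 ho
    change tmk x' y' = (a • tmk x y) <• b at hab
    rw [smul_tmk, tmk_smul, tmk_eq] at hab
    obtain ⟨h, h1, h2⟩ := hab
    refine Prod.ext (gmk_eq.2 ⟨a, h, h1⟩) (gmk_eq.2 ⟨h⁻¹, b, ?_⟩)
    have e : (h⁻¹ • y) <• b = h⁻¹ • (y <• b) := (smul_comm _ _ _).symm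
    rw [e, ← h2, inv_smul_smul]
  · intro o
    obtain ⟨z, χ, h, rfl⟩ := gmk_surj o
    obtain ⟨x, y, rfl⟩ := tmk_surj z
    obtain ⟨φ, ψ, hx, hy⟩ := HasGraph.of_tmk h
    exact ⟨(gmk x φ hx, gmk y ψ hy), gmk_eq.2 ⟨1, 1, by simp⟩⟩

theorem rho_tensor [Finite G] (X Y : Biset G G) : rho (X.tensor Y) = rho X * rho Y := by
  have := Fintype.ofFinite X.GraphOrbit
  have := Fintype.ofFinite Y.GraphOrbit
  have e : rho (X.tensor Y) = ∑ᶠ o : X.GraphOrbit × Y.GraphOrbit,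
      MonoidAlgebra.of ℤ (Out G) (tensorOrbit X Y o).out :=
    (finsum_eq_of_bijective _ (tensorOrbit_bijective X Y) fun _ => rfl).symm
  rw [e, rho, rho, finsum_eq_sum_of_fintype, finsum_eq_sum_of_fintype, finsum_eq_sum_of_fintype,
    Finset.sum_mul_sum, Fintype.sum_prod_type]
  refine Finset.sum_congr rfl fun o _ => Finset.sum_congr rfl fun o' _ => ?_
  obtain ⟨x, φ, hx, rfl⟩ := gmk_surj o
  obtain ⟨y, ψ, hy, rfl⟩ := gmk_surj o'
  rw [← map_mul]
  rfl

/-- The subgroup `Δ_φ(G) = {(g, h) | g = φ h}` of `G × G`, that is `(G, 1, φ, G, 1)`. -/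
def graphSubgroup (φ : MulAut G) : Subgroup (G × G) where
  carrier := {p | p.1 = φ p.2}
  one_mem' := by simp
  mul_mem' := by
    rintro ⟨a, b⟩ ⟨c, d⟩ h k
    change a = φ b at h
    change c = φ d at k
    change a * c = φ (b * d)
    rw [h, k, map_mul]
  inv_mem' := by
    rintro ⟨a, b⟩ h
    change a = φ b at h
    change a⁻¹ = φ b⁻¹
    rw [h, map_inv]

variable [Finite G]

/-- The set `G` with the `(G, G)`-action `g • x • h = g x φ(h)`. -/
def iso (φ : MulAut G) : Biset G G := ofHoms (MonoidHom.id G) φ.toMonoidHom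

theorem coset_graph_iso (φ : MulAut G) : Iso (coset (graphSubgroup φ)) (iso φ) := by
  refine Iso.of_bijective (Quotient.lift (fun p : G × G => (p.1 * φ p.2⁻¹ : G)) ?_) ⟨?_, ?_⟩ ?_ ?_
  · rintro ⟨a, b⟩ ⟨c, d⟩ h
    have h : a⁻¹ * c = φ (b⁻¹ * d) := QuotientGroup.leftRel_apply.1 h
    change a * φ b⁻¹ = c * φ d⁻¹
    have hc : c = a * φ (b⁻¹ * d) := by rw [← h]; simp
    rw [hc, mul_assoc, ← map_mul]
    simp
  · intro p q
    refine Quotient.inductionOn₂ p q ?_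
    rintro ⟨a, b⟩ ⟨c, d⟩ h
    change a * φ b⁻¹ = c * φ d⁻¹ at h
    refine Quotient.sound (QuotientGroup.leftRel_apply.2 ?_)
    change a⁻¹ * c = φ (b⁻¹ * d)
    have hc : c = a * φ b⁻¹ * φ d := by rw [h, mul_assoc, ← map_mul]; simp
    rw [hc, map_mul]
    group
  · intro (x : G)
    exact ⟨QuotientGroup.mk ((x, 1) : G × G), show x * φ 1⁻¹ = x by simp⟩
  · intro g p
    refine Quotient.inductionOn p ?_
    rintro ⟨a, b⟩
    change g * a * φ (1 * b)⁻¹ = g * (a * φ b⁻¹)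
    rw [one_mul, mul_assoc]
  · intro p k
    refine Quotient.inductionOn p ?_
    rintro ⟨a, b⟩
    change 1 * a * φ (k⁻¹ * b)⁻¹ = a * φ b⁻¹ * φ k
    rw [one_mul, mul_assoc, ← map_mul]
    simp

theorem iso_tensor_iso (φ ψ : MulAut G) : Iso (tensor (iso φ) (iso ψ)) (iso (φ * ψ)) :=
  ofHoms_tensor_iso (MonoidHom.id G) (MonoidHom.id G) ψ.toMonoidHom φ.toMonoidHom
    Function.surjective_id

theorem iso_conj_iso (a : G) : Iso (iso (MulAut.conj a)) (identity G) := by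
  refine Iso.of_bijective (fun x : G => (x * a : G))
    ⟨mul_left_injective a, fun (x : G) => ⟨show G from x * a⁻¹, inv_mul_cancel_right x a⟩⟩ ?_ ?_
  · intro g (x : G)
    exact mul_assoc g x a
  · intro (x : G) k
    change x * (a * k * a⁻¹) * a = x * a * k
    group

theorem hasGraph_iso (φ : MulAut G) : (iso φ).HasGraph (1 : G) φ := by
  intro g h
  change g * 1 = 1 * φ h ↔ g = φ h
  rw [mul_one, one_mul]

theorem rho_iso (φ : MulAut G) : rho (iso φ) = MonoidAlgebra.of ℤ (Out G) (outMk φ) := by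
  have hu : ∀ o : (iso φ).GraphOrbit, o = gmk (1 : G) φ (hasGraph_iso φ) := fun o => by
    obtain ⟨x, ψ, h, rfl⟩ := gmk_surj o
    change G at x
    refine (gmk_eq.2 ⟨x, 1, ?_⟩).symm
    change x = x * 1 * φ 1
    simp
  rw [rho, finsum_eq_single _ (gmk (1 : G) φ (hasGraph_iso φ)) fun o ho => (ho (hu o)).elim]
  rfl

/-- A transitive biset `G × G / M` has an orbit counted by `ρ` only if `M` is some `Δ_φ(G)`. -/
theorem rho_coset_of_ne (M : Subgroup (G × G)) (hM : ∀ φ, M ≠ graphSubgroup φ) :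
    rho (coset M) = 0 := by
  have : IsEmpty (coset M).GraphOrbit := ⟨fun o => by
    obtain ⟨x, φ, h, -⟩ := gmk_surj o
    obtain ⟨⟨a, b⟩, rfl⟩ := QuotientGroup.mk_surjective (s := M) x
    have key := h.move a⁻¹ b
    refine hM (MulAut.conj a⁻¹ * φ * MulAut.conj b) ?_
    ext ⟨g, k⟩
    refine Iff.trans ?_ (key g k)
    change _ ↔ (QuotientGroup.mk
      (((g, 1) : G × G) * ((1, b⁻¹) * ((a⁻¹, 1) * (a, b)))) : (G × G) ⧸ M) =
      QuotientGroup.mk (((1, k⁻¹) : G × G) * ((1, b⁻¹) * ((a⁻¹, 1) * (a, b))))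
    rw [eq_comm, QuotientGroup.eq]
    simp⟩
  exact finsum_of_isEmpty _

end Biset

variable [Finite G]

/-- The ring homomorphism `ρ : B(G, G) → ℤ Out(G)`: it sends `[G × G / Δ_φ(G)]` to `φ̄` and
`[G × G / M]` to `0` if `M` is not of the form `Δ_φ(G)`. -/
noncomputable def rho : B G G →+* MonoidAlgebra ℤ (Out G) :=
  { B.liftBiset Biset.rho (fun _ _ => Biset.rho_congr) Biset.rho_empty Biset.rho_sum with
    map_one' := (B.liftBiset_cls _ _ _ _ (Biset.identity G)).trans (Biset.rho_iso 1)
    map_mul' := fun a b => by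
      change B.liftBiset Biset.rho (fun _ _ => Biset.rho_congr) Biset.rho_empty Biset.rho_sum _ =
        B.liftBiset Biset.rho (fun _ _ => Biset.rho_congr) Biset.rho_empty Biset.rho_sum _ *
          B.liftBiset Biset.rho (fun _ _ => Biset.rho_congr) Biset.rho_empty Biset.rho_sum _
      rw [mul_def]
      induction a using B.induction with
      | hadd a a' h h' => rw [add_comp, map_add, map_add, h, h', add_mul]
      | hneg a h => rw [neg_comp, map_neg, map_neg, h, neg_mul]
      | hc X =>
        induction b using B.induction with
        | hadd a a' h h' => rw [comp_add, map_add, map_add, h, h', mul_add]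
        | hneg a h => rw [comp_neg, map_neg, map_neg, h, mul_neg]
        | hc Y =>
          rw [comp_cls, B.liftBiset_cls, B.liftBiset_cls, B.liftBiset_cls, Biset.rho_tensor] }

theorem rho_cls (X : Biset G G) : rho (cls X) = Biset.rho X := B.liftBiset_cls _ _ _ _ X

theorem cls_coset_graph (φ : MulAut G) :
    cls (Biset.coset (Biset.graphSubgroup φ)) = cls (Biset.iso φ) :=
  cls_eq (Biset.coset_graph_iso φ)

theorem rho_coset_graph (φ : MulAut G) :
    rho (cls (Biset.coset (Biset.graphSubgroup φ))) = MonoidAlgebra.of ℤ (Out G) (outMk φ) := by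
  rw [cls_coset_graph, rho_cls, Biset.rho_iso]

theorem rho_coset_of_ne (M : Subgroup (G × G)) (hM : ∀ φ, M ≠ Biset.graphSubgroup φ) :
    rho (cls (Biset.coset M)) = 0 := by
  rw [rho_cls, Biset.rho_coset_of_ne M hM]

theorem cls_iso_mul (φ ψ : MulAut G) :
    cls (Biset.iso (φ * ψ)) = cls (Biset.iso φ) * cls (Biset.iso ψ) := by
  rw [mul_def, comp_cls]
  exact (cls_eq (Biset.iso_tensor_iso φ ψ)).symm

/-- `φ̄ ↦ [G × G / Δ_φ(G)]`, as a homomorphism from `Out(G)` to the monoid `B(G, G)`. -/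
noncomputable def etaOut : Out G →* B G G where
  toFun := Quotient.lift (fun φ : MulAut G => cls (Biset.coset (Biset.graphSubgroup φ))) (by
    intro φ ψ h
    obtain ⟨a, ha⟩ := QuotientGroup.leftRel_apply.1 h
    have e : ψ = φ * MulAut.conj a := by rw [ha, mul_inv_cancel_left]
    change cls _ = cls _
    rw [cls_coset_graph, cls_coset_graph, e, cls_iso_mul, cls_eq (Biset.iso_conj_iso a),
      ← one_def, mul_one])
  map_one' := cls_coset_graph 1
  map_mul' := by
    rintro ⟨φ⟩ ⟨ψ⟩
    change cls (Biset.coset (Biset.graphSubgroup (φ * ψ))) =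
      cls (Biset.coset (Biset.graphSubgroup φ)) * cls (Biset.coset (Biset.graphSubgroup ψ))
    rw [cls_coset_graph, cls_coset_graph, cls_coset_graph, cls_iso_mul]

theorem etaOut_mk (φ : MulAut G) :
    etaOut (outMk φ) = cls (Biset.coset (Biset.graphSubgroup φ)) := rfl

/-- The ring homomorphism `η : ℤ Out(G) → B(G, G)`, `φ̄ ↦ [G × G / Δ_φ(G)]`. -/
noncomputable def eta : MonoidAlgebra ℤ (Out G) →+* B G G :=
  MonoidAlgebra.liftNCRingHom (Int.castRingHom (B G G)) etaOut
    (fun n _ => Int.cast_commute n _)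

theorem eta_of (φ : MulAut G) : eta (MonoidAlgebra.of ℤ (Out G) (outMk φ)) =
    cls (Biset.coset (Biset.graphSubgroup φ)) := by
  rw [← etaOut_mk]
  simp [eta]

/-- The subgroup `⟨-Id, Out(G)⟩` of `(ℤ Out(G))ˣ`. -/
noncomputable def signedOut (G : Type u) [Group G] : Subgroup (MonoidAlgebra ℤ (Out G))ˣ :=
  Subgroup.closure ({-1} ∪ Set.range (MonoidHom.toHomUnits (MonoidAlgebra.of ℤ (Out G))))

end Rho

end DoubleBurnside

open DoubleBurnside

/-! Everything rests on `ρ` and `η` respecting duality. Let `x ↦ x*` be the additive map of `ℤ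
Out(G)` inverting group elements (`antipode`). An orbit of type `Δ_φ(G)` becomes one of type
`Δ_{φ⁻¹}(G)` in the opposite biset, so `ρ(a°) = ρ(a)*` (`rho_dual`), and `η(x)° = η(x*)` in the same
way (`dual_eta`).

For an orthogonal unit `γ` the element `x = ρ(γ)` therefore satisfies `x x* = 1`. The coefficient of
`x x*` at `1` is the sum of the squares of the integer coefficients of `x`. This sum being `1`,
exactly one coefficient is nonzero and it is `±1`, so `x` is a signed group element. Conversely a
signed group element satisfies `x x* = x* x = 1`, so `η` sends it to an orthogonal unit. Since `ρ ∘
η = id`, the restriction of `η` splits that of `ρ`, which gives surjectivity, injectivity and the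
semidirect product.

The last two statements need `I_G = ker ρ` (`mem_idealI_iff`). By a Goursat count, `|P₁(M)/K₁(M)| =
|G|` only when `M` is some `Δ_φ(G)`, so all other transitive bisets lie in `I_G`. Hence `a - η(ρ(a))
∈ I_G` for every `a`; no linear independence of the transitive bisets is required. The
correspondence `u ↦ 1 - u` is then the expansion of `(1 - a)(1 - a°)`. For inflation, a nontrivial
`N` acts trivially from the left on `Inf ∘ X ∘ Def`, so no orbit there has a graph as stabilizer and
`ρ` vanishes. -/

namespace DoubleBurnside

open scoped RightActions

/-! ### Integral group rings: the inversion map and signed group elements. -/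

section GroupRing

variable {A : Type*} [Group A]

/-- The additive map `∑ n_a a ↦ ∑ n_a a⁻¹` of the integral group ring. -/
noncomputable def antipode : MonoidAlgebra ℤ A →+ MonoidAlgebra ℤ A where
  toFun := MonoidAlgebra.mapDomain (·⁻¹)
  map_zero' := MonoidAlgebra.mapDomain_zero _
  map_add' := MonoidAlgebra.mapDomain_add _

theorem antipode_single (a : A) (n : ℤ) :
    antipode (MonoidAlgebra.single a n) = MonoidAlgebra.single a⁻¹ n :=
  MonoidAlgebra.mapDomain_single

theorem antipode_of (a : A) :
    antipode (MonoidAlgebra.of ℤ A a) = MonoidAlgebra.of ℤ A a⁻¹ :=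
  antipode_single a 1

/-- The coefficient of `x y*` at `1` is the inner product of the coefficients of `x` and `y`. -/
theorem coeff_mul_antipode_one [Fintype A] (x y : MonoidAlgebra ℤ A) :
    (x * antipode y).coeff 1 = ∑ a, x.coeff a * y.coeff a := by
  classical
  induction y using MonoidAlgebra.induction_linear with
  | zero => simp
  | add y z hy hz =>
    simp only [map_add, mul_add, MonoidAlgebra.coeff_add, Finsupp.add_apply, hy, hz,
      Finset.sum_add_distrib]
  | single b n =>
    -- Right multiplication by `n b⁻¹` moves the coefficient of `x` at `b` to the identity, scaled
    -- by `n`; on the other side only the summand at `b` survives.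
    rw [antipode_single, Finset.sum_eq_single b]
    · simp
    · intro a _ hab
      simp [hab.symm]
    · simp

/-- An element `x` of the integral group ring with `x x* = 1` is a signed group element. -/
theorem exists_sign_of_mul_antipode_eq_one [Finite A] {x : MonoidAlgebra ℤ A}
    (hx : x * antipode x = 1) :
    ∃ (a : A) (ε : ℤˣ), x = (ε : ℤ) • MonoidAlgebra.of ℤ A a := by
  have := Fintype.ofFinite A
  have h : ∑ a, x.coeff a * x.coeff a = 1 := by
    rw [← coeff_mul_antipode_one, hx, MonoidAlgebra.coeff_one_one]
  obtain ⟨a, ha⟩ : ∃ a, x.coeff a ≠ 0 := by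
    by_contra! h0
    simp [h0] at h
  classical
  rw [← Finset.add_sum_erase _ _ (Finset.mem_univ a)] at h
  -- Integrality enters here: one nonzero coefficient already uses up the whole sum `1`, so the
  -- squares of the others add up to `0`.
  have h1 : 1 ≤ x.coeff a * x.coeff a := Int.add_one_le_iff.2 (mul_self_pos.2 ha)
  have h2 : 0 ≤ ∑ b ∈ Finset.univ.erase a, x.coeff b * x.coeff b :=
    Finset.sum_nonneg fun b _ => mul_self_nonneg _
  have h3 : x.coeff a * x.coeff a = 1 := by linarith
  have h4 : ∑ b ∈ Finset.univ.erase a, x.coeff b * x.coeff b = 0 := by linarith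
  -- The sign is the coefficient itself, a unit of `ℤ` because its square is `1`.
  refine ⟨a, Units.mkOfMulEqOne _ _ h3, ?_⟩
  ext b
  by_cases hb : b = a
  · subst hb
    simp
  · have := (Finset.sum_eq_zero_iff_of_nonneg fun b _ => mul_self_nonneg _).1 h4 b
      (Finset.mem_erase.2 ⟨hb, Finset.mem_univ b⟩)
    simp [mul_self_eq_zero.1 this, Ne.symm hb]

/-- A signed group element determines the sign and the group element. -/
theorem sign_smul_of_injective : Function.Injective
    fun p : A × ℤˣ => (p.2 : ℤ) • MonoidAlgebra.of ℤ A p.1 := by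
  rintro ⟨a, ε⟩ ⟨b, δ⟩ h
  have h1 : Finsupp.single a (ε : ℤ) = Finsupp.single b (δ : ℤ) := by
    simpa using congrArg MonoidAlgebra.coeff h
  rcases (Finsupp.single_eq_single_iff _ _ _ _).1 h1 with ⟨rfl, h2⟩ | ⟨h2, -⟩
  · exact congrArg (Prod.mk a) (Units.ext h2)
  -- The remaining case has both coefficients zero, impossible for a sign.
  · exact (ε.ne_zero h2).elim

end GroupRing

/-- Signs are central and their own inverses, so the elements `ε a` are closed under products and
inverses, with `(ε a)⁻¹ = ε a⁻¹`. The generated subgroup thus contains nothing else. -/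
theorem mem_signedOut {G : Type u} [Group G] {v : (MonoidAlgebra ℤ (Out G))ˣ} :
    v ∈ signedOut G ↔ ∃ (a : Out G) (ε : ℤˣ),
      (v : MonoidAlgebra ℤ (Out G)) = (ε : ℤ) • MonoidAlgebra.of ℤ (Out G) a := by
  constructor
  · intro hv
    induction hv using Subgroup.closure_induction with
    | mem v h =>
      rcases h with rfl | ⟨a, rfl⟩
      · exact ⟨1, -1, by rw [map_one]; simp⟩
      · exact ⟨a, 1, by simp⟩
    | one => exact ⟨1, 1, by rw [map_one]; simp⟩
    | mul v w _ _ hv hw =>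
      obtain ⟨a, ε, hv⟩ := hv
      obtain ⟨b, δ, hw⟩ := hw
      exact ⟨a * b, ε * δ, by rw [Units.val_mul, hv, hw, smul_mul_smul_comm, ← map_mul,
        Units.val_mul]⟩
    | inv v _ hv =>
      obtain ⟨a, ε, hv⟩ := hv
      refine ⟨a⁻¹, ε, Units.inv_eq_of_mul_eq_one_right ?_⟩
      rw [hv, smul_mul_smul_comm, ← map_mul, Int.units_coe_mul_self, mul_inv_cancel, map_one,
        one_smul]
  · rintro ⟨a, ε, hv⟩
    have ha : MonoidHom.toHomUnits (MonoidAlgebra.of ℤ (Out G)) a ∈ signedOut G :=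
      Subgroup.subset_closure (Or.inr ⟨a, rfl⟩)
    have hn : (-1 : (MonoidAlgebra ℤ (Out G))ˣ) ∈ signedOut G :=
      Subgroup.subset_closure (Or.inl rfl)
    rcases Int.units_eq_one_or ε with rfl | rfl
    · convert ha
      ext1
      simpa using hv
    · convert mul_mem hn ha
      ext1
      simpa using hv

/-! ### Opposite bisets under `ρ`, and the decomposition into orbits. -/

namespace Biset

variable {G H : Type u} [Group G] [Group H]

/-- Taking opposites interchanges the two coordinates of a stabilizer, and the graph of `φ` with
coordinates interchanged is the graph of `φ⁻¹`. -/
theorem hasGraph_opp {X : Biset G G} {x : X} {φ : MulAut G} (h : X.HasGraph x φ) :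
    X.opp.HasGraph x φ⁻¹ := by
  intro a b
  change x <• a⁻¹ = b⁻¹ • x ↔ _
  rw [eq_comm, h, map_inv, inv_inj, eq_comm, MulAut.inv_apply, MulEquiv.eq_symm_apply]

/-- The orbits of an opposite biset. -/
def oppOrbit (X : Biset G G) : X.GraphOrbit → X.opp.GraphOrbit :=
  Quotient.map (fun p => ⟨(p.1.1, p.1.2⁻¹), hasGraph_opp p.2⟩) (by
    rintro ⟨⟨x, φ⟩, hx⟩ ⟨⟨y, ψ⟩, hy⟩ ⟨a, b, h⟩
    change y = (a • x) <• b at h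
    -- In the opposite biset, left multiplication by `b⁻¹` is the old right multiplication by `b`,
    -- and symmetrically for `a`.
    refine ⟨b⁻¹, a⁻¹, ?_⟩
    change y = a⁻¹⁻¹ • (x <• b⁻¹⁻¹)
    rw [h, inv_inv, inv_inv]
    exact (smul_comm a (MulOpposite.op b) x).symm)

theorem oppOrbit_bijective (X : Biset G G) : Function.Bijective (oppOrbit X) := by
  constructor
  · intro o o' ho
    obtain ⟨x, φ, h, rfl⟩ := gmk_surj o
    obtain ⟨y, ψ, k, rfl⟩ := gmk_surj o'
    obtain ⟨a, b, hab⟩ := gmk_eq.1 ho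
    change y = b⁻¹ • (x <• a⁻¹) at hab
    exact gmk_eq.2 ⟨b⁻¹, a⁻¹, by rw [hab, smul_comm]⟩
  · intro o
    obtain ⟨x, φ, h, rfl⟩ := gmk_surj o
    change X at x
    -- The converse of `hasGraph_opp`, on the same underlying set: the hypothesis at `(b⁻¹, a⁻¹)` is
    -- the claim at `(a, b)` after cancelling double inverses.
    have h' : X.HasGraph x φ⁻¹ := by
      intro a b
      have := h b⁻¹ a⁻¹
      change x <• b⁻¹⁻¹ = a⁻¹⁻¹ • x ↔ _ at this
      rw [inv_inv, inv_inv, eq_comm, map_inv, inv_inj] at this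
      rw [this, MulAut.inv_apply, MulEquiv.eq_symm_apply, eq_comm]
    exact ⟨gmk x φ⁻¹ h', gmk_eq.2 ⟨1, 1, by
      change x = (1 : G)⁻¹ • (x <• (1 : G)⁻¹)
      simp⟩⟩

/-- A biset and its opposite have the same orbits, and the automorphism class of each counted orbit
is inverted. This is what links orthogonality in `B(G, G)` to the equation `x x* = 1` in the group
ring. -/
theorem rho_opp [Finite G] (X : Biset G G) : rho X.opp = antipode (rho X) := by
  have := Fintype.ofFinite X.GraphOrbit
  have e : rho X.opp = ∑ᶠ o : X.GraphOrbit, MonoidAlgebra.of ℤ (Out G) (oppOrbit X o).out :=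
    (finsum_eq_of_bijective _ (oppOrbit_bijective X) fun _ => rfl).symm
  rw [e, rho, finsum_eq_sum_of_fintype, finsum_eq_sum_of_fintype, map_sum]
  refine Finset.sum_congr rfl fun o _ => ?_
  obtain ⟨x, φ, h, rfl⟩ := gmk_surj o
  rw [antipode_of]
  rfl

/-- The stabilizer `{(g, h) | g x h⁻¹ = x}` of a point. -/
def stab (X : Biset G H) (x : X) : Subgroup (G × H) where
  carrier := {p | p.1 • x = x <• p.2}
  one_mem' := by simp
  mul_mem' := by
    rintro ⟨a, b⟩ ⟨c, d⟩ h k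
    change a • x = x <• b at h
    change c • x = x <• d at k
    change (a * c) • x = x <• (b * d)
    rw [mul_smul, k, smul_comm, h, act_mul]
  inv_mem' := by
    rintro ⟨a, b⟩ h
    change a • x = x <• b at h
    change a⁻¹ • x = x <• b⁻¹
    rw [inv_smul_eq_iff, smul_comm, h, ← act_mul]
    simp

/-- The biset of the points of `X` outside the orbit of `x`. -/
def removeOrbit (X : Biset G H) (x : X) : Biset G H :=
  ofOps {y : X // ∀ (a : G) (b : H), y ≠ (a • x) <• b}
    (fun g y => ⟨g • y.1, fun a b h => y.2 (g⁻¹ * a) b (by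
      rw [mul_smul, ← smul_comm g⁻¹ (MulOpposite.op b), ← h, inv_smul_smul])⟩)
    (fun y k => ⟨y.1 <• k, fun a b h => y.2 a (b * k⁻¹) (by
      rw [act_mul, ← h, ← act_mul]
      simp)⟩)
    (fun y => Subtype.ext (one_smul _ _)) (fun g g' y => Subtype.ext (mul_smul _ _ _))
    (fun y => Subtype.ext (by simp)) (fun y h h' => Subtype.ext (act_mul _ _ _))
    (fun g y h => Subtype.ext (smul_comm _ _ _))

/-- Orbit-stabilizer: `(a, b) ↦ a x b⁻¹` identifies the cosets of the stabilizer with the orbit of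
`x`, and the other summand is the complement of that orbit. -/
theorem sum_coset_removeOrbit_iso [Finite G] [Finite H] (X : Biset G H) (x : X) :
    Iso (sum (coset (X.stab x)) (X.removeOrbit x)) X := by
  let f : (G × H) ⧸ X.stab x → X := Quotient.lift (fun p : G × H => (p.1 • x) <• p.2⁻¹) (by
    rintro ⟨a, b⟩ ⟨c, d⟩ h
    have h : (a⁻¹ * c) • x = x <• (b⁻¹ * d) := QuotientGroup.leftRel_apply.1 h
    change (a • x) <• b⁻¹ = (c • x) <• d⁻¹
    rw [mul_smul, inv_smul_eq_iff] at h
    rw [h, ← smul_comm a (MulOpposite.op d⁻¹), ← act_mul, ← smul_comm a (MulOpposite.op b⁻¹)]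
    simp)
  refine Iso.of_bijective (Sum.elim f Subtype.val) ⟨Function.Injective.sumElim ?_
    Subtype.val_injective ?_, ?_⟩ ?_ ?_
  · intro p q
    refine Quotient.inductionOn₂ p q ?_
    rintro ⟨a, b⟩ ⟨c, d⟩ h
    change (a • x) <• b⁻¹ = (c • x) <• d⁻¹ at h
    refine Quotient.sound (QuotientGroup.leftRel_apply.2 ?_)
    change (a⁻¹ * c) • x = x <• (b⁻¹ * d)
    have hc : c • x = ((a • x) <• b⁻¹) <• d := by rw [h, ← act_mul]; simp
    rw [mul_smul, hc, ← act_mul, ← smul_comm a, inv_smul_smul]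
  · intro p
    refine Quotient.inductionOn p ?_
    rintro ⟨a, b⟩ y h
    exact y.2 a b⁻¹ h.symm
  · intro y
    by_cases hy : ∃ (a : G) (b : H), y = (a • x) <• b
    · obtain ⟨a, b, rfl⟩ := hy
      refine ⟨Sum.inl (QuotientGroup.mk ((a, b⁻¹) : G × H)), ?_⟩
      change (a • x) <• b⁻¹⁻¹ = _
      rw [inv_inv]
    · push Not at hy
      exact ⟨Sum.inr ⟨y, hy⟩, rfl⟩
  · rintro g (p | y)
    · refine Quotient.inductionOn p ?_
      rintro ⟨a, b⟩
      change ((g * a) • x) <• (1 * b)⁻¹ = g • ((a • x) <• b⁻¹)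
      rw [one_mul, mul_smul, smul_comm g (MulOpposite.op b⁻¹)]
    · rfl
  · rintro (p | y) k
    · refine Quotient.inductionOn p ?_
      rintro ⟨a, b⟩
      change ((1 * a) • x) <• (k⁻¹ * b)⁻¹ = ((a • x) <• b⁻¹) <• k
      rw [one_mul, mul_inv_rev, inv_inv, act_mul]
    · rfl

end Biset

/-- Every biset is a sum of transitive bisets. -/
theorem closure_cls_coset {G H : Type u} [Group G] [Group H] [Finite G] [Finite H] :
    AddSubgroup.closure (Set.range fun L : Subgroup (G × H) => cls (Biset.coset L)) = ⊤ := by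
  rw [eq_top_iff, ← B.closure_cls, AddSubgroup.closure_le]
  rintro _ ⟨X, rfl⟩
  -- Orbits are split off one at a time; the complement of the orbit of `x` misses `x = 1 x 1`, so
  -- it is strictly smaller.
  induction hn : Nat.card X using Nat.strong_induction_on generalizing X with
  | _ n ih =>
    rcases isEmpty_or_nonempty X with hX | ⟨⟨x⟩⟩
    · have : IsEmpty (Biset.empty G H) := inferInstanceAs (IsEmpty PEmpty)
      have e : Biset.Iso X (Biset.empty G H) :=
        ⟨Equiv.equivOfIsEmpty _ _, fun _ p => isEmptyElim p, fun p _ => isEmptyElim p⟩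
      rw [cls_eq e, cls_empty]
      exact zero_mem _
    · rw [← cls_eq (X.sum_coset_removeOrbit_iso x), cls_sum]
      refine add_mem (AddSubgroup.subset_closure ⟨_, rfl⟩) (ih _ ?_ _ rfl)
      rw [← hn]
      exact Finite.card_subtype_lt (p := fun y : X => ∀ (a : G) (b : H), y ≠ (a • x) <• b)
        (x := x) fun h => h 1 1 (by simp)

/-! ### Goursat counting and the equality `I_G = ker ρ`. -/

section Ideal

variable {G : Type u} [Group G]

theorem goursatFst_le_map_fst (M : Subgroup (G × G)) :
    M.goursatFst ≤ M.map (MonoidHom.fst G G) := fun _ h =>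
  ⟨_, Subgroup.mem_goursatFst.1 h, rfl⟩

theorem goursatSnd_le_map_snd (M : Subgroup (G × G)) :
    M.goursatSnd ≤ M.map (MonoidHom.snd G G) := fun _ h =>
  ⟨_, Subgroup.mem_goursatSnd.1 h, rfl⟩

theorem card_mul_relIndex_of_le {A : Type*} [Group A] {H K : Subgroup A} (h : H ≤ K) :
    Nat.card H * H.relIndex K = Nat.card K := by
  rw [← Subgroup.relIndex_bot_left, ← Subgroup.relIndex_bot_left,
    Subgroup.relIndex_mul_relIndex _ _ _ bot_le h]

/-- The first projection restricted to `M` has image `P₁(M)` and kernel `1 × K₂(M)`, so `|K₂(M)|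
|P₁(M)| = |M|`. -/
theorem card_goursatSnd_mul_card_map_fst (M : Subgroup (G × G)) :
    Nat.card M.goursatSnd * Nat.card (M.map (MonoidHom.fst G G)) = Nat.card M := by
  have hk : Nat.card M.goursatSnd = Nat.card ↥((MonoidHom.fst G G).ker ⊓ M) :=
    Nat.card_congr
      { toFun := fun h => ⟨(1, h), rfl, Subgroup.mem_goursatSnd.1 h.2⟩
        invFun := fun p => ⟨p.1.2, by
          obtain ⟨⟨a, b⟩, h1, h2⟩ := p
          obtain rfl : a = 1 := h1
          exact Subgroup.mem_goursatSnd.2 h2⟩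
        left_inv := fun _ => rfl
        right_inv := by
          rintro ⟨⟨a, b⟩, h1, h2⟩
          obtain rfl : a = 1 := h1
          rfl }
  rw [hk, ← Subgroup.relIndex_ker, ← Subgroup.inf_relIndex_right,
    card_mul_relIndex_of_le inf_le_right]

theorem card_goursatFst_mul_card_map_snd (M : Subgroup (G × G)) :
    Nat.card M.goursatFst * Nat.card (M.map (MonoidHom.snd G G)) = Nat.card M := by
  have hk : Nat.card M.goursatFst = Nat.card ↥((MonoidHom.snd G G).ker ⊓ M) :=
    Nat.card_congr
      { toFun := fun h => ⟨(h, 1), rfl, Subgroup.mem_goursatFst.1 h.2⟩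
        invFun := fun p => ⟨p.1.1, by
          obtain ⟨⟨a, b⟩, h1, h2⟩ := p
          obtain rfl : b = 1 := h1
          exact Subgroup.mem_goursatFst.2 h2⟩
        left_inv := fun _ => rfl
        right_inv := by
          rintro ⟨⟨a, b⟩, h1, h2⟩
          obtain rfl : b = 1 := h1
          rfl }
  rw [hk, ← Subgroup.relIndex_ker, ← Subgroup.inf_relIndex_right,
    card_mul_relIndex_of_le inf_le_right]

/-- The quotients `P₁(M) / K₁(M)` and `P₂(M) / K₂(M)` have the same order. -/
theorem relIndex_goursatFst_eq [Finite G] (M : Subgroup (G × G)) :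
    M.goursatFst.relIndex (M.map (MonoidHom.fst G G)) =
      M.goursatSnd.relIndex (M.map (MonoidHom.snd G G)) := by
  -- Both `|K₂| |P₁|` and `|K₁| |P₂|` equal `|M|`. Substituting `|Pᵢ| = |Kᵢ| |Pᵢ/Kᵢ|` leaves the
  -- common factor `|K₁| |K₂|` to cancel.
  have h1 := card_goursatSnd_mul_card_map_fst M
  rw [← card_goursatFst_mul_card_map_snd M,
    ← card_mul_relIndex_of_le (goursatFst_le_map_fst M),
    ← card_mul_relIndex_of_le (goursatSnd_le_map_snd M), ← mul_assoc, ← mul_assoc,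
    mul_comm (Nat.card M.goursatSnd)] at h1
  exact Nat.eq_of_mul_eq_mul_left (Nat.mul_pos Nat.card_pos Nat.card_pos) h1

/-- In `|H| |K : H| = |K| ≤ |A|`, an index of at least `|A|` leaves room only for `|H| = 1` and `|K|
= |A|`. -/
theorem eq_bot_and_eq_top_of_card_le_relIndex {A : Type*} [Group A] [Finite A]
    {H K : Subgroup A} (hHK : H ≤ K) (h : Nat.card A ≤ H.relIndex K) : H = ⊥ ∧ K = ⊤ := by
  have h1 := card_mul_relIndex_of_le hHK
  have h2 : Nat.card K ≤ Nat.card A := Subgroup.card_le_card_group K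
  have h3 : 0 < Nat.card H := Nat.card_pos
  have h4 : 0 < Nat.card A := Nat.card_pos
  refine ⟨Subgroup.eq_bot_of_card_le H ?_, Subgroup.eq_top_of_le_card K ?_⟩
  · by_contra! h5
    nlinarith
  · nlinarith

/-- If `|P₁(M) / K₁(M)| = |G|`, then `M` is the graph of an automorphism. -/
theorem exists_eq_graphSubgroup [Finite G] (M : Subgroup (G × G))
    (h : Nat.card G ≤ M.goursatFst.relIndex (M.map (MonoidHom.fst G G))) :
    ∃ φ, M = Biset.graphSubgroup φ := by
  obtain ⟨hK1, -⟩ := eq_bot_and_eq_top_of_card_le_relIndex (goursatFst_le_map_fst M) h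
  rw [relIndex_goursatFst_eq] at h
  obtain ⟨hK2, hP2⟩ := eq_bot_and_eq_top_of_card_le_relIndex (goursatSnd_le_map_snd M) h
  -- `P₂ = G` gives each `b` a partner `f b`. Triviality of `K₁` makes the partner unique, hence `f`
  -- multiplicative; triviality of `K₂` makes `f` injective, hence bijective since `G` is finite.
  have h0 : ∀ b : G, ∃ a, (a, b) ∈ M := fun b => by
    have hb : b ∈ M.map (MonoidHom.snd G G) := hP2 ▸ Subgroup.mem_top b
    obtain ⟨⟨a, _⟩, hab, rfl⟩ := hb
    exact ⟨a, hab⟩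
  choose f hf using h0
  have hu : ∀ {a b}, (a, b) ∈ M → a = f b := fun {a b} hab => by
    have : a * (f b)⁻¹ ∈ M.goursatFst := Subgroup.mem_goursatFst.2 (by
      simpa using mul_mem hab (inv_mem (hf b)))
    rw [hK1, Subgroup.mem_bot] at this
    exact mul_inv_eq_one.1 this
  have hinj : Function.Injective f := fun b c hbc => by
    have : b * c⁻¹ ∈ M.goursatSnd := Subgroup.mem_goursatSnd.2 (by
      simpa [hbc] using mul_mem (hf b) (inv_mem (hf c)))
    rw [hK2, Subgroup.mem_bot] at this
    exact mul_inv_eq_one.1 this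
  refine ⟨{ Equiv.ofBijective f (Finite.injective_iff_bijective.1 hinj) with
    map_mul' := fun b c => (hu (mul_mem (hf b) (hf c))).symm }, ?_⟩
  ext ⟨a, b⟩
  constructor
  · exact fun hab => hu hab
  · intro hab
    obtain rfl : a = f b := hab
    exact hf b

theorem relIndex_graphSubgroup (φ : MulAut G) :
    (Biset.graphSubgroup φ).goursatFst.relIndex
      ((Biset.graphSubgroup φ).map (MonoidHom.fst G G)) = Nat.card G := by
  have h1 : (Biset.graphSubgroup φ).goursatFst = ⊥ := by
    refine (Subgroup.eq_bot_iff_forall _).2 fun a ha => ?_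
    have : a = φ 1 := Subgroup.mem_goursatFst.1 ha
    rw [this, map_one]
  have h2 : (Biset.graphSubgroup φ).map (MonoidHom.fst G G) = ⊤ :=
    eq_top_iff.2 fun a _ => ⟨(a, φ⁻¹ a), (MulAut.apply_inv_self _ φ a).symm, rfl⟩
  rw [h1, h2, Subgroup.relIndex_bot_left, Subgroup.card_top]

variable [Finite G]

/-- The equality of the two indices is automatic, so only the strict bound can fail, and its failure
makes `M` a graph. -/
theorem cls_coset_mem_idealI {M : Subgroup (G × G)} (hM : ∀ φ, M ≠ Biset.graphSubgroup φ) :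
    cls (Biset.coset M) ∈ idealI G := by
  refine AddSubgroup.subset_closure ⟨M, relIndex_goursatFst_eq M, ?_, rfl⟩
  by_contra! h
  obtain ⟨φ, hφ⟩ := exists_eq_graphSubgroup M h
  exact hM φ hφ

/-- By additivity it suffices to look at transitive bisets: the difference is `0` for `Δ_φ(G)`, and
is the biset itself, a generator of `I_G`, otherwise. -/
theorem sub_eta_rho_mem_idealI (a : B G G) : a - eta (rho a) ∈ idealI G := by
  have ha : a ∈ AddSubgroup.closure
      (Set.range fun L : Subgroup (G × G) => cls (Biset.coset L)) := by
    rw [closure_cls_coset]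
    trivial
  induction ha using AddSubgroup.closure_induction with
  | mem x h =>
    obtain ⟨M, rfl⟩ := h
    dsimp only
    by_cases hM : ∃ φ, M = Biset.graphSubgroup φ
    · obtain ⟨φ, rfl⟩ := hM
      rw [rho_coset_graph, eta_of, sub_self]
      exact zero_mem _
    · push Not at hM
      rw [rho_coset_of_ne M hM, map_zero, sub_zero]
      exact cls_coset_mem_idealI hM
  | zero => simp
  | add a b _ _ ha hb =>
    rw [map_add, map_add, add_sub_add_comm]
    exact add_mem ha hb
  | neg a _ ha =>
    rw [map_neg, map_neg, ← neg_sub']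
    exact neg_mem ha

/-- `I_G` is the kernel of `ρ`. -/
theorem mem_idealI_iff {a : B G G} : a ∈ idealI G ↔ rho a = 0 := by
  constructor
  · intro ha
    induction ha using AddSubgroup.closure_induction with
    | mem x h =>
      obtain ⟨M, -, h, rfl⟩ := h
      -- A graph has index exactly `|G|`, which the strict bound in the definition of `I_G`
      -- excludes.
      refine rho_coset_of_ne M ?_
      rintro φ rfl
      rw [relIndex_graphSubgroup] at h
      exact lt_irrefl _ h
    | zero => exact map_zero _
    | add a b _ _ ha hb => rw [map_add, ha, hb, add_zero]
    | neg a _ ha => rw [map_neg, ha, neg_zero]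
  · intro h
    simpa [h] using sub_eta_rho_mem_idealI a

/-! ### Duality under `ρ` and `η`, the section `η`, and the vanishing of `ρ` on inflations. -/

theorem rho_dual (a : B G G) : rho (dual a) = antipode (rho a) := by
  induction a using B.induction with
  | hadd a b ha hb => simp only [map_add, ha, hb]
  | hneg a ha => simp only [map_neg, ha]
  | hc X => rw [dual_cls, rho_cls, rho_cls, Biset.rho_opp]

theorem rho_eta (x : MonoidAlgebra ℤ (Out G)) : rho (eta x) = x := by
  induction x using MonoidAlgebra.induction_linear with
  | zero => simp
  | add x y hx hy => rw [map_add, map_add, hx, hy]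
  | single a n =>
    obtain ⟨φ, rfl⟩ := QuotientGroup.mk_surjective a
    have : MonoidAlgebra.single (outMk φ) n = n • MonoidAlgebra.of ℤ (Out G) (outMk φ) := by simp
    change rho (eta (MonoidAlgebra.single (outMk φ) n)) = MonoidAlgebra.single (outMk φ) n
    rw [this, map_zsmul, map_zsmul, eta_of, rho_coset_graph]

/-- The opposite of the `φ`-twisted biset is `G` with action `φ(g) x h`; applying `φ⁻¹` to the
points moves the twist back to the right, as `φ⁻¹`. -/
theorem dual_cls_iso (φ : MulAut G) : dual (cls (Biset.iso φ)) = cls (Biset.iso φ⁻¹) := by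
  rw [dual_cls]
  refine cls_eq ((Biset.opp_ofHoms_iso _ _).trans (Biset.Iso.of_bijective
    (fun x : G => φ⁻¹ x) (φ⁻¹).bijective ?_ ?_))
  · intro g (x : G)
    change φ⁻¹ (φ g * x) = g * φ⁻¹ x
    rw [map_mul, MulAut.inv_apply_self]
  · intro (x : G) h
    change φ⁻¹ (x * h) = φ⁻¹ x * φ⁻¹ h
    rw [map_mul]

theorem dual_eta (x : MonoidAlgebra ℤ (Out G)) : dual (eta x) = eta (antipode x) := by
  induction x using MonoidAlgebra.induction_linear with
  | zero => simp
  | add x y hx hy => rw [map_add, map_add, map_add, map_add, hx, hy]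
  | single a n =>
    obtain ⟨φ, rfl⟩ := QuotientGroup.mk_surjective a
    have : MonoidAlgebra.single (outMk φ) n = n • MonoidAlgebra.of ℤ (Out G) (outMk φ) := by simp
    change dual (eta (MonoidAlgebra.single (outMk φ) n)) =
      eta (antipode (MonoidAlgebra.single (outMk φ) n))
    have hi : (outMk φ)⁻¹ = outMk φ⁻¹ := rfl
    rw [this, map_zsmul, map_zsmul, map_zsmul, map_zsmul, antipode_of, hi, eta_of, eta_of,
      cls_coset_graph, cls_coset_graph, dual_cls_iso]

/-- `N` acts trivially from the left on `Inf`, so each stabilizer in `Inf ∘ X ∘ Def` contains `N ×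
1`. A graph `Δ_φ(G)` meets `G × 1` trivially, so for `N ≠ 1` no orbit is counted by `ρ`. -/
theorem rho_inflate {N : Subgroup G} [N.Normal] (hN : N ≠ ⊥) (a : B (G ⧸ N) (G ⧸ N)) :
    rho (inflate N a) = 0 := by
  induction a using B.induction with
  | hadd a b ha hb => rw [inflate_add, map_add, ha, hb, add_zero]
  | hneg a ha =>
    have : inflate N (-a) = -inflate N a := by simp only [inflate, comp_neg, neg_comp]
    rw [this, map_neg, ha, neg_zero]
  | hc X =>
    rw [inflate, comp_cls, comp_cls, rho_cls]
    have : IsEmpty (((Biset.inf N).tensor X).tensor (Biset.defl N)).GraphOrbit := ⟨fun o => by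
      obtain ⟨z, φ, h, -⟩ := Biset.gmk_surj o
      obtain ⟨p, y, rfl⟩ := Biset.tmk_surj z
      obtain ⟨q, x, rfl⟩ := Biset.tmk_surj p
      refine hN ((Subgroup.eq_bot_iff_forall _).2 fun n hn => ?_)
      have hq : n • q = q := by
        change G ⧸ N at q
        change QuotientGroup.mk' N n * q = q
        rw [QuotientGroup.mk'_apply, (QuotientGroup.eq_one_iff n).2 hn, one_mul]
      have := (h n 1).1 (by rw [Biset.smul_tmk, Biset.smul_tmk, hq]; simp)
      rwa [map_one] at this⟩
    exact finsum_of_isEmpty _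

theorem rho_inflateUnit {N : Subgroup G} [N.Normal] (hN : N ≠ ⊥) (u : B (G ⧸ N) (G ⧸ N)) :
    rho (inflateUnit N u) = 1 := by
  rw [inflateUnit, map_add, map_one, rho_inflate hN, add_zero]

end Ideal

/-! ### Restriction of `ρ` and `η` to orthogonal units and signed outer automorphisms. -/

section OrthogonalUnits

variable {G : Type u} [Group G] [Finite G]

/-- Applying `ρ` to `γ γ° = 1` gives `ρ(γ) ρ(γ)* = 1`, and the sum-of-squares argument applies
because `Out(G)` is finite. -/
theorem exists_rho_eq {γ : (B G G)ˣ} (hγ : γ ∈ orthogonalUnits G) :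
    ∃ (a : Out G) (ε : ℤˣ), rho (γ : B G G) = (ε : ℤ) • MonoidAlgebra.of ℤ (Out G) a := by
  have : Finite (MulAut G) :=
    Finite.of_injective (fun φ : MulAut G => (φ : G → G)) DFunLike.coe_injective
  refine exists_sign_of_mul_antipode_eq_one ?_
  rw [← rho_dual, ← map_mul, hγ.1, map_one]

/-- For a signed group element, `x*` is the two-sided inverse of `x`; `η` is multiplicative and
turns `*` into `°`. -/
theorem eta_mem_orthogonalUnits {v : (MonoidAlgebra ℤ (Out G))ˣ} (hv : v ∈ signedOut G) :
    Units.map (eta (G := G)).toMonoidHom v ∈ orthogonalUnits G := by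
  obtain ⟨a, ε, hv⟩ := mem_signedOut.1 hv
  have h1 : (v : MonoidAlgebra ℤ (Out G)) * antipode (v : MonoidAlgebra ℤ (Out G)) = 1 := by
    rw [hv, map_zsmul, antipode_of, smul_mul_smul_comm, ← map_mul, Int.units_coe_mul_self,
      mul_inv_cancel, map_one, one_smul]
  have h2 : antipode (v : MonoidAlgebra ℤ (Out G)) * (v : MonoidAlgebra ℤ (Out G)) = 1 := by
    rw [hv, map_zsmul, antipode_of, smul_mul_smul_comm, ← map_mul, Int.units_coe_mul_self,
      inv_mul_cancel, map_one, one_smul]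
  constructor
  · change eta (v : MonoidAlgebra ℤ (Out G)) * dual (eta (v : MonoidAlgebra ℤ (Out G))) = 1
    rw [dual_eta, ← map_mul, h1, map_one]
  · change dual (eta (v : MonoidAlgebra ℤ (Out G))) * eta (v : MonoidAlgebra ℤ (Out G)) = 1
    rw [dual_eta, ← map_mul, h2, map_one]

variable (G) in
/-- The restriction of `ρ` to the orthogonal units. -/
noncomputable def rhoOrth : orthogonalUnits G →* signedOut G :=
  ((Units.map (rho (G := G)).toMonoidHom).comp (orthogonalUnits G).subtype).codRestrict
    (signedOut G) (fun u => mem_signedOut.2 (exists_rho_eq u.2))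

variable (G) in
/-- The restriction of `η` to the signed outer automorphisms. -/
noncomputable def etaOrth : signedOut G →* orthogonalUnits G :=
  ((Units.map (eta (G := G)).toMonoidHom).comp (signedOut G).subtype).codRestrict
    (orthogonalUnits G) (fun v => eta_mem_orthogonalUnits v.2)

theorem rhoOrth_comp_etaOrth : (rhoOrth G).comp (etaOrth G) = MonoidHom.id (signedOut G) := by
  ext v : 1
  exact Subtype.ext (Units.ext (rho_eta _))

theorem mem_ker_rhoOrth {u : orthogonalUnits G} :
    u ∈ (rhoOrth G).ker ↔ rho ((u : (B G G)ˣ) : B G G) = 1 := by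
  rw [MonoidHom.mem_ker, Subtype.ext_iff, Units.ext_iff]
  rfl

/-- The image of a section of a group homomorphism is a complement of the kernel. -/
theorem isComplement'_range_ker {A C : Type*} [Group A] [Group C] {r : A →* C} {s : C →* A}
    (h : r.comp s = MonoidHom.id C) : Subgroup.IsComplement' s.range r.ker := by
  have hrs : ∀ c, r (s c) = c := DFunLike.congr_fun h
  refine Subgroup.isComplement'_of_disjoint_and_mul_eq_univ ?_ ?_
  · rw [Subgroup.disjoint_def]
    rintro _ ⟨c, rfl⟩ hc
    rw [MonoidHom.mem_ker, hrs] at hc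
    rw [hc, map_one]
  -- The factorization is `a = s(r a) · (s(r a)⁻¹ a)`, whose second factor is killed by `r` because
  -- `r ∘ s = id`.
  · refine Set.eq_univ_of_forall fun a => ⟨s (r a), ⟨r a, rfl⟩, (s (r a))⁻¹ * a, ?_, ?_⟩
    · rw [SetLike.mem_coe, MonoidHom.mem_ker, map_mul, map_inv, hrs, inv_mul_cancel]
    · exact mul_inv_cancel_left _ _

/-- With `u = 1 - a`, `u u° = 1 - a - a° + a a°`, so `u u° = 1` means `a a° = a + a°`, and likewise
for `u° u`. Moreover `ρ(u) = 1` means `ρ(a) = 0`, that is `a ∈ I_G`. The map `u ↦ 1 - u` is its own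
inverse. -/
theorem bijOn_one_sub_ker_rhoOrth :
    Set.BijOn (fun u : orthogonalUnits G => 1 - ((u : (B G G)ˣ) : B G G)) (rhoOrth G).ker
      {a | a ∈ idealI G ∧ a * dual a = dual a * a ∧ dual a * a = a + dual a} := by
  refine ⟨?_, ?_, ?_⟩
  · intro u hu
    obtain ⟨h1, h2⟩ := u.2
    refine ⟨mem_idealI_iff.2 ?_, ?_, ?_⟩
    · rw [map_sub, map_one, mem_ker_rhoOrth.1 hu, sub_self]
    · simp only [map_sub, dual_one, mul_sub, sub_mul, h1, h2, one_mul, mul_one]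
      abel
    · simp only [map_sub, dual_one, mul_sub, sub_mul, h2, one_mul, mul_one]
      abel
  · intro u _ v _ h
    exact Subtype.ext (Units.ext (sub_right_injective h))
  · rintro a ⟨ha, h1, h2⟩
    have k1 : (1 - a) * dual (1 - a) = 1 := by
      simp only [map_sub, dual_one, mul_sub, sub_mul, one_mul, mul_one, h1, h2]
      abel
    have k2 : dual (1 - a) * (1 - a) = 1 := by
      simp only [map_sub, dual_one, mul_sub, sub_mul, one_mul, mul_one, h2]
      abel
    -- The dual serves as the inverse, so the same two identities give invertibility and
    -- orthogonality.
    refine ⟨⟨⟨1 - a, dual (1 - a), k1, k2⟩, k1, k2⟩, mem_ker_rhoOrth.2 ?_, sub_sub_cancel 1 a⟩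
    change rho (1 - a) = 1
    rw [map_sub, map_one, mem_idealI_iff.1 ha, sub_zero]

end OrthogonalUnits

end DoubleBurnside

theorem lemma4 (G : Type u) [Group G] [Finite G] :
    -- (i) `ρ(γ) = ε φ̄` for a unique `φ̄` and a unique sign `ε`
    (∀ γ ∈ orthogonalUnits G, ∃! p : Out G × ℤˣ,
      rho (γ : B G G) = (p.2 : ℤ) • MonoidAlgebra.of ℤ (Out G) p.1) ∧
    ∃ (rhoX : orthogonalUnits G →* signedOut G) (etaX : signedOut G →* orthogonalUnits G),
      -- `rhoX` is the restriction of `ρ`, and it is surjective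
      (∀ u : orthogonalUnits G,
        ((rhoX u : (MonoidAlgebra ℤ (Out G))ˣ) : MonoidAlgebra ℤ (Out G)) =
          rho ((u : (B G G)ˣ) : B G G)) ∧
      Function.Surjective rhoX ∧
      -- (ii) `etaX` is the restriction of `η`, it is injective and a section of `rhoX`
      (∀ v : signedOut G, ((etaX v : (B G G)ˣ) : B G G) =
        eta ((v : (MonoidAlgebra ℤ (Out G))ˣ) : MonoidAlgebra ℤ (Out G))) ∧
      Function.Injective etaX ∧
      rhoX.comp etaX = MonoidHom.id (signedOut G) ∧
      -- `B_∘(G, G)` is the internal semidirect product of `im η` and the normal subgroup `ker ρˣ`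
      rhoX.ker.Normal ∧ Subgroup.IsComplement' etaX.range rhoX.ker ∧
      -- (iii) `u ↦ Id - u` is the correspondence between `ker ρˣ` and such `a` in `I_G`
      Set.BijOn (fun u : orthogonalUnits G => 1 - ((u : (B G G)ˣ) : B G G)) rhoX.ker
        {a | a ∈ idealI G ∧ a * dual a = dual a * a ∧ dual a * a = a + dual a} ∧
      -- (iv)
      ∀ (N : Subgroup G) [N.Normal], N ≠ ⊥ → (dBInfOrth N).range ≤ rhoX.ker := by
  -- This single identity yields both the surjectivity of the restricted `ρ` and the injectivity of
  -- the restricted `η`.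
  have hs : Function.LeftInverse (rhoOrth G) (etaOrth G) :=
    DFunLike.congr_fun rhoOrth_comp_etaOrth
  refine ⟨fun γ hγ => ?_, rhoOrth G, etaOrth G, fun _ => rfl, hs.surjective, fun _ => rfl,
    hs.injective, rhoOrth_comp_etaOrth, inferInstance,
    isComplement'_range_ker rhoOrth_comp_etaOrth, bijOn_one_sub_ker_rhoOrth, ?_⟩
  · obtain ⟨a, ε, h⟩ := exists_rho_eq hγ
    exact ⟨(a, ε), h, fun p hp => sign_smul_of_injective (hp.symm.trans h)⟩
  · rintro N _ hN _ ⟨u, rfl⟩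
    exact mem_ker_rhoOrth.2 (rho_inflateUnit hN ((u : (B (G ⧸ N) (G ⧸ N))ˣ) : B (G ⧸ N) (G ⧸ N)))
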